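/- **Setting.** Let $\mathsf C=\{0,1\}^{\mathbb N}$ with the pointwise order. For $F:\mathsf C\to\mathsf C$ define $f^F_\beta\in\mathsf C$ by transfinite recursion: $f^F_0=0$, $f^F_{\beta+1}=\max\{f^F_\beta,F(f^F_\beta)\}$, and $f^F_\beta=\sup_{\gamma<\beta}f^F_\gamma$ for limit $\beta$. Let $\mathcal I(F)=f^F_{\alpha}$, where $\alpha$ is the least ordinal with $f^F_\alpha=f^F_{\alpha+1}$ (*non-monotone induction*). For partial $F:\mathsf C\rightharpoonup\mathsf C$ (each $F(f)$ is either an element of $\mathsf C$ or totally undefined), $f^F_\beta$ is *defined* if $\beta=0$, or if $f^F_\gamma$ and $F(f^F_\gamma)$ are defined for all $\gamma<\beta$; $\mathcal I(F)$ is *defined*, with value $f^F_\alpha$, if there is an $\alpha$ such that $f^F_{\alpha+1}$ is defined and $f^F_\alpha=f^F_{\alpha+1}$. For $G:\mathbb N^{\mathbb N}\rightharpoonup\mathbb N$ put $F_G(f)(n)=\min\{G(n^\frown f),1\}$, where $n^\frown f$ is the sequence $n,f(0),f(1),\dots$, and $F_G(f)$ is undefined unless $G(n^\frown f)$ is defined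 for all $n$. For finite sequences $\vec F$ of total functionals $\mathbb N^{\mathbb N}\to\mathbb N$, $\vec f$ of functions $\mathbb N\to\mathbb N$, $\vec a$ of natural numbers (of arbitrary lengths), and $e,c\in\mathbb N$, the relation $\{e\}(\mathcal I,\vec F,\vec f,\vec a)=c$ is inductively defined by the following schemes, where $\langle\cdots\rangle$ is the standard bijective coding of finite sequences of numbers, $\langle\,\rangle=0$ and $\langle x_1,\dots,x_r\rangle=1+\pi(x_1,\langle x_2,\dots,x_r\rangle)$, with $\pi(x,y)=y^2+x$ if $x<y$ and $\pi(x,y)=x^2+x+y$ otherwise. * S1: if $e=\langle1\rangle$, then $\{e\}(\mathcal I,\vec F,\vec f,\vec a)=a_1+1$. * S2: if $e=\langle2,q\rangle$, then $\{e\}(\mathcal I,\vec F,\vec f,\vec a)=q$. * S3: if $e=\langle3\rangle$, then $\{e\}(\mathcal I,\vec F,\vec f,\vec a)=a_1$. * S4: if $e=\langle4,e_1,e_2\rangle$, $\{e_2\}(\mathcal I,\vec F,\vec f,\vec a)=b$ and $\{e_1\}(\mathcal I,\vec F,\vec f,b,\vec a)=c$, then $\{e\}(\mathcal I,\vec F,\vec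 f,\vec a)=c$. * S6: if $e=\langle6,e_1,\tau_1,\tau_2,\tau_3\rangle$, where $\tau_1,\tau_2,\tau_3$ code permutations of the index sets of $\vec F,\vec f,\vec a$, then $\{e\}(\mathcal I,\vec F,\vec f,\vec a)=\{e_1\}(\mathcal I,\vec F_{\tau_1},\vec f_{\tau_2},\vec a_{\tau_3})$. (A code lists the values of the permutation on an initial segment of the index set that it maps onto itself; all further indices are fixed.) * S7: if $e=\langle7\rangle$, then $\{e\}(\mathcal I,\vec F,\vec f,\vec a)=f_1(a_1)$. * S8.2: if $e=\langle8,2,d\rangle$ and $g(a)=\{d\}(\mathcal I,\vec F,\vec f,a,\vec a)$ is a total function, then $\{e\}(\mathcal I,\vec F,\vec f,\vec a)=F_1(g)$. * S8.3: if $e=\langle8,3,d\rangle$, then $\{e\}(\mathcal I,\vec F,\vec f,b,\vec a)=\mathcal I(F_G)(b)$, where $G(f)=\{d\}(\mathcal I,\vec F,f,\vec f,\vec a)$. * S9: if $e=\langle9\rangle$ and $\{d\}(\mathcal I,\vec F,\vec f,\vec a)=c$, then $\{e\}(\mathcal I,\vec F,\vec f,d,\vec a)=c$. Write $\{e\}_t(\mathcal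 I,\vec F,\vec f,\vec a)=c$ for the relation obtained when $G$ in S8.3 is required to be total on $\mathbb N^{\mathbb N}$, and $\{e\}_p(\mathcal I,\vec F,\vec f,\vec a)=c$ for the relation obtained when $G$ in S8.3 may be partial and it is only required that $\mathcal I(F_G)$ is defined in the sense above. **Theorem.** (1) There is a Turing computable function $\rho:\mathbb N\to\mathbb N$ such that for all $e,\vec F,\vec f,\vec a,b$: if $\{e\}_p(\mathcal I,\vec F,\vec f,\vec a)=b$, then $\{\rho(e)\}_t(\mathcal I,\vec F,\vec f,\vec a)=b$. (2) Hence the two interpretations have the same computational power: for every set $D$ of inputs $(\vec F,\vec f,\vec a)$ and every function $\Phi$ from inputs to $\mathbb N$, there is an index $e$ with $\{e\}_p(\mathcal I,\vec F,\vec f,\vec a)=\Phi(\vec F,\vec f,\vec a)$ for all $(\vec F,\vec f,\vec a)\in D$ if and only if there is an index $e$ with $\{e\}_t(\mathcal I,\vec F,\vec f,\vec a)=\Phi(\vec F,\vec f,\vec a)$ for all $(\vec F,\vec f,\vec a)\in D$. -/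

import Mathlib

namespace NonMonotoneInduction

/-- The Cantor set `{0,1}^ℕ`, ordered pointwise (`false` is `0`, `true` is `1`). -/
abbrev Cantor : Type := ℕ → Bool

/-- Total functionals of pure type 2. -/
abbrev Tp2 : Type := (ℕ → ℕ) → ℕ

/-- `f_β^F` for a total `F`, by transfinite recursion: `f_0 = 0`, `f_{β+1} = max (f_β, F (f_β))`, and
`f_β = sup_{γ < β} f_γ` for limit `β`. -/
noncomputable def stage (F : Cantor → Cantor) (β : Ordinal.{0}) : Cantor :=
  Ordinal.limitRecOn β ⊥ (fun _ f => f ⊔ F f) (fun β _ f => ⨆ γ : Set.Iio β, f γ.1 γ.2)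

/-- `α_F`, the least ordinal `α` with `f_α = f_{α+1}`. -/
noncomputable def closureOrdinal (F : Cantor → Cantor) : Ordinal.{0} :=
  sInf {α | stage F α = stage F (α + 1)}

/-- Non-monotone induction `𝓘 (F) = f_{α_F}` for total `F`. -/
noncomputable def ind (F : Cantor → Cantor) : Cantor :=
  stage F (closureOrdinal F)

/-- `PStage F β f`: for the partial `F`, the stage `f_β^F` is defined and equals `f`.
It is defined if `β = 0`, or if both `f_γ^F` and `F (f_γ^F)` are defined for all `γ < β`. -/
inductive PStage (F : Cantor →. Cantor) : Ordinal.{0} → Cantor → Prop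
  | zero : PStage F 0 ⊥
  | succ {β : Ordinal.{0}} {f g : Cantor} (hf : PStage F β f) (hg : g ∈ F f) :
      PStage F (β + 1) (f ⊔ g)
  | limit {β : Ordinal.{0}} (hβ : Order.IsSuccLimit β) (s : Ordinal.{0} → Cantor)
      (hs : ∀ γ < β, PStage F γ (s γ)) (hF : ∀ γ < β, (F (s γ)).Dom) :
      PStage F β (⨆ γ : Set.Iio β, s γ.1)

/-- `PInd F A`: for the partial `F`, `𝓘 (F)` is defined and equals `A`, that is, there is an `α` such
that `f_{α+1}^F` is defined and `A = f_α^F = f_{α+1}^F`. -/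
def PInd (F : Cantor →. Cantor) (A : Cantor) : Prop :=
  ∃ α : Ordinal.{0}, PStage F α A ∧ PStage F (α + 1) A

/-- The concatenation `n ⌢ f`, an element of `ℕ^ℕ`. -/
def concat (n : ℕ) (f : Cantor) : ℕ → ℕ
  | 0 => n
  | k + 1 => (f k).toNat

/-- `F_G (f) (n) = min {G (n ⌢ f), 1}` for total `G`. -/
def codedOp (G : Tp2) (f : Cantor) : Cantor :=
  fun n => decide (min (G (concat n f)) 1 = 1)

/-- `F_G` for partial `G`: `F_G (f)` is defined when `G (n ⌢ f)` is defined for every `n`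
(otherwise it is totally undefined), and then `F_G (f) (n) = min {G (n ⌢ f), 1}`. -/
def codedPOp (G : (ℕ → ℕ) →. ℕ) (f : Cantor) : Part Cantor :=
  ⟨∀ n, (G (concat n f)).Dom, fun h n => decide (min ((G (concat n f)).get (h n)) 1 = 1)⟩

/-- The original reading of the application of `𝓘`: `G` has to be a total functional of type 2. -/
def TotalApp (G : (ℕ → ℕ) →. ℕ) (A : Cantor) : Prop :=
  ∃ G' : Tp2, G = (G' : (ℕ → ℕ) →. ℕ) ∧ A = ind (codedOp G')

/-- The liberal reading of the application of `𝓘`: `G` may be partial, as long as `𝓘 (F_G)` is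
defined. -/
def PartialApp (G : (ℕ → ℕ) →. ℕ) (A : Cantor) : Prop :=
  PInd (codedPOp G) A

/-- The sequence number `⟨x₁, …, x_r⟩`. -/
def seqNum (x : List ℕ) : ℕ := Encodable.encode x

/-- The list `t` codes a permutation of the index set of `l`: the values of `t` are a permutation of
an initial segment `{0, …, t.length - 1}` of the index set, and the remaining indices are fixed. -/
def PermCode {α : Type} (t : List ℕ) (l : List α) : Prop :=
  t.Perm (List.range t.length) ∧ t.length ≤ l.length

/-- The sequence `l_τ`, with `i`-th entry the `τ i`-th entry of `l`, for `τ` the permutation coded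
by `t`. -/
def permuted {α : Type} (t : List ℕ) (l : List α) : List α :=
  t.filterMap (fun i => l[i]?) ++ l.drop t.length

/-- `Kleene App e Fs fs as c` is `{e}(𝓘, F⃗, f⃗, a⃗) = c`, the relation inductively defined by the
schemes S1 - S4, S6 - S9, where `App G A` is the reading of "`𝓘 (F_G)` is defined and equals `A`"
that is used in S8 for the application of `𝓘`.
In `s8_3`, `G` is a part of `λ f. {d}(𝓘, F⃗, f, f⃗, a⃗)` that suffices for the application of `𝓘`.
Both readings are monotone in the graph of `G`, so this is the same as taking the whole of it, but
the clause is positive. -/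
inductive Kleene (App : ((ℕ → ℕ) →. ℕ) → Cantor → Prop) :
    ℕ → List Tp2 → List (ℕ → ℕ) → List ℕ → ℕ → Prop
  | s1 {e : ℕ} {Fs : List Tp2} {fs : List (ℕ → ℕ)} {a : ℕ} {as : List ℕ}
      (he : e = seqNum [1]) : Kleene App e Fs fs (a :: as) (a + 1)
  | s2 {e : ℕ} {Fs : List Tp2} {fs : List (ℕ → ℕ)} {as : List ℕ} {q : ℕ}
      (he : e = seqNum [2, q]) : Kleene App e Fs fs as q
  | s3 {e : ℕ} {Fs : List Tp2} {fs : List (ℕ → ℕ)} {a : ℕ} {as : List ℕ}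
      (he : e = seqNum [3]) : Kleene App e Fs fs (a :: as) a
  | s4 {e : ℕ} {Fs : List Tp2} {fs : List (ℕ → ℕ)} {as : List ℕ} {e₁ e₂ b c : ℕ}
      (he : e = seqNum [4, e₁, e₂])
      (h₂ : Kleene App e₂ Fs fs as b) (h₁ : Kleene App e₁ Fs fs (b :: as) c) :
      Kleene App e Fs fs as c
  | s6 {e : ℕ} {Fs : List Tp2} {fs : List (ℕ → ℕ)} {as : List ℕ} {e₁ c : ℕ} {t₁ t₂ t₃ : List ℕ}
      (he : e = seqNum [6, e₁, seqNum t₁, seqNum t₂, seqNum t₃])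
      (ht₁ : PermCode t₁ Fs) (ht₂ : PermCode t₂ fs) (ht₃ : PermCode t₃ as)
      (h : Kleene App e₁ (permuted t₁ Fs) (permuted t₂ fs) (permuted t₃ as) c) :
      Kleene App e Fs fs as c
  | s7 {e : ℕ} {Fs : List Tp2} {f : ℕ → ℕ} {fs : List (ℕ → ℕ)} {a : ℕ} {as : List ℕ}
      (he : e = seqNum [7]) : Kleene App e Fs (f :: fs) (a :: as) (f a)
  | s8_2 {e : ℕ} {F : Tp2} {Fs : List Tp2} {fs : List (ℕ → ℕ)} {as : List ℕ} {d : ℕ}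
      (he : e = seqNum [8, 2, d]) (g : ℕ → ℕ)
      (hg : ∀ x, Kleene App d (F :: Fs) fs (x :: as) (g x)) :
      Kleene App e (F :: Fs) fs as (F g)
  | s8_3 {e : ℕ} {Fs : List Tp2} {fs : List (ℕ → ℕ)} {b : ℕ} {as : List ℕ} {d : ℕ}
      (he : e = seqNum [8, 3, d]) (G : (ℕ → ℕ) →. ℕ)
      (hG : ∀ f, ∀ c ∈ G f, Kleene App d Fs (f :: fs) as c)
      (A : Cantor) (hA : App G A) :
      Kleene App e Fs fs (b :: as) (A b).toNat
  | s9 {e : ℕ} {Fs : List Tp2} {fs : List (ℕ → ℕ)} {d : ℕ} {as : List ℕ} {c : ℕ}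
      (he : e = seqNum [9]) (h : Kleene App d Fs fs as c) :
      Kleene App e Fs fs (d :: as) c

/-- `{e}_t(𝓘, F⃗, f⃗, a⃗) = c`. -/
def TComp (e : ℕ) (Fs : List Tp2) (fs : List (ℕ → ℕ)) (as : List ℕ) (c : ℕ) : Prop :=
  Kleene TotalApp e Fs fs as c

/-- `{e}_p(𝓘, F⃗, f⃗, a⃗) = c`. -/
def PComp (e : ℕ) (Fs : List Tp2) (fs : List (ℕ → ℕ)) (as : List ℕ) (c : ℕ) : Prop :=
  Kleene PartialApp e Fs fs as c

/-- The functional `Φ` is computed on the set `D` of input sequences by some index, with respect to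
the computation relation `R`. -/
def ComputableOn (R : ℕ → List Tp2 → List (ℕ → ℕ) → List ℕ → ℕ → Prop)
    (D : Set (List Tp2 × List (ℕ → ℕ) × List ℕ))
    (Φ : List Tp2 → List (ℕ → ℕ) → List ℕ → ℕ) : Prop :=
  ∃ e : ℕ, ∀ Fs fs as, (Fs, fs, as) ∈ D → R e Fs fs as (Φ Fs fs as)

end NonMonotoneInduction

/-!
The liberal reading of the application of `𝓘` is simulated by the original one. The heart of the
matter is to replace a partial `G`, for which `𝓘 (F_G)` is defined, by a total functional that is
computable uniformly from an index of `G`, and from whose induction `𝓘 (F_G)` can be read off.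

The induction over `H = F_G` is replaced by one that builds up its history `X`, a set of pairs with
sections `X_y = {x | ⟨x, y⟩ ∈ X}`: the section `X_0` is the present stage, and `X_{z+1}` is the
stage at which `z` entered. A condition on arbitrary sets `X` that makes `X_0` a stage, and that
holds for all histories, can be decided without evaluating `H` outside its stages. First, the relation "`z + 1` is below `y` if `z ∈ X_y`" is tested for
well-foundedness below `0`, which is an application of `𝓘` to a total functional (`tb_accIdx`). If
it is well-founded, then the correctness `Ok H X y` of the sections is decided by recursion along
it: `X_y` is correct if for all `z ∈ X_y` the section `X_{z+1}` is correct, `z ∈ H (X_{z+1})`, and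
`X_{z+1} ∪ H (X_{z+1}) ⊆ X_y`. Correct sections are stages (`Ok.exists_stage`), so `H` is
evaluated at stages only, where it is defined. Once `X` has been found correct, `H (X_0)` is
evaluated and determines the next history (`HistStep`); a set that is not correct is not enlarged.
This operator is total (`EvaluatesStages.tb_stepIdx`), and its induction runs through the histories
of the induction over `H` (`stage_histStep`, `ind_histStep`).

This has to be done for all indices at once, and the functions `n ⌢ X_y` at which `G` is evaluated
are not among the function arguments but only computable from them. So an interpreter is defined
(`interp`), which evaluates an index at arguments that are given by references to the actual ones,
and which is itself evaluated in the original reading. By induction on computations in the liberal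
reading it evaluates all of them correctly (`evaluates_of_pComp`). The function `ρ` maps `e` to the
index that runs the interpreter on `e`.

The interpreter needs the primitive recursive functions, for which there is no scheme. Universal
evaluation (S9) gives recursion, by self-application, and it gives branching, because `12` and `13`
happen to be indices of different functions (`exists_branch`). The order of the numbers is
obtained from `𝓘` (`tb_ltIdx`), and primitive recursion is then a loop
(`exists_index_of_primrec'`). Number quantifiers are inductions, too (`tb_ex`).
-/

namespace NonMonotoneInduction

/-! ### Stages of non-monotone inductions -/

lemma cantor_iSup_apply {ι : Sort*} (s : ι → Cantor) (n : ℕ) :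
    (⨆ i, s i) n = true ↔ ∃ i, s i n = true := by
  constructor
  · intro h
    by_contra hc
    push Not at hc
    have h1 : (⨆ i, s i) ≤ fun m => decide (m ≠ n) := by
      refine iSup_le fun i m => ?_
      by_cases hm : m = n
      · subst hm
        have := hc i
        simp_all
      · simp [hm, Bool.le_true]
    have := h1 n
    rw [h] at this
    simpa using top_le_iff.1 this
  · rintro ⟨i, hi⟩
    have := le_iSup s i n
    rw [hi] at this
    exact top_le_iff.1 this

lemma cantor_le_iff {f g : Cantor} : f ≤ g ↔ ∀ n, f n = true → g n = true := by
  constructor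
  · intro h n hn
    have := h n
    rw [hn] at this
    exact top_le_iff.1 this
  · intro h n
    cases hf : f n
    · exact Bool.false_le _
    · rw [h n hf]

lemma cantor_sup_apply (f g : Cantor) (n : ℕ) :
    (f ⊔ g) n = true ↔ f n = true ∨ g n = true := by
  simp [Pi.sup_apply]

lemma cantor_ext {f g : Cantor} (h : ∀ n, f n = true ↔ g n = true) : f = g :=
  funext fun n => Bool.eq_iff_iff.2 (h n)

section Stage

variable (F : Cantor → Cantor)

lemma stage_zero : stage F 0 = ⊥ := by
  simp [stage]

lemma stage_add_one (β : Ordinal.{0}) : stage F (β + 1) = stage F β ⊔ F (stage F β) := by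
  simp [stage]

lemma stage_limit {β : Ordinal.{0}} (h : Order.IsSuccLimit β) :
    stage F β = ⨆ γ : Set.Iio β, stage F γ.1 := by
  rw [stage, Ordinal.limitRecOn_limit _ _ _ _ h]
  rfl

lemma stage_mono : Monotone (stage F) := by
  intro β γ h
  induction γ using Ordinal.limitRecOn with
  | zero => rw [nonpos_iff_eq_zero.1 h]
  | add_one γ ih =>
    rcases h.eq_or_lt with rfl | h
    · rfl
    · exact (ih (Order.lt_add_one_iff.1 h)).trans (by rw [stage_add_one]; exact le_sup_left)
  | limit γ hγ ih =>
    rcases h.eq_or_lt with rfl | h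
    · rfl
    · rw [stage_limit F hγ]
      exact le_iSup (fun δ : Set.Iio γ => stage F δ.1) ⟨β, h⟩

variable {F}

lemma stage_eq_of_fixed {α : Ordinal.{0}} (h : stage F α = stage F (α + 1)) {γ : Ordinal.{0}}
    (hγ : α ≤ γ) : stage F γ = stage F α := by
  induction γ using Ordinal.limitRecOn with
  | zero => rw [nonpos_iff_eq_zero.1 hγ]
  | add_one γ ih =>
    rcases hγ.eq_or_lt with rfl | hlt
    · rfl
    · rw [stage_add_one, ih (Order.lt_add_one_iff.1 hlt), ← stage_add_one, ← h]
  | limit γ hl ih =>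
    refine le_antisymm ?_ (stage_mono F hγ)
    rw [stage_limit F hl]
    refine iSup_le fun δ => ?_
    rcases le_total α δ.1 with h1 | h1
    · exact (ih δ.1 δ.2 h1).le
    · exact stage_mono F h1

variable (F) in
/-- The stages cannot be pairwise different, as there are more ordinals than subsets of `ℕ`. -/
lemma exists_stage_fixed : ∃ α : Ordinal.{0}, stage F α = stage F (α + 1) := by
  by_contra hc
  push Not at hc
  refine not_injective_of_ordinal (stage F) fun α β hab => ?_
  by_contra hne
  have key : ∀ α β : Ordinal.{0}, stage F α = stage F β → ¬ α < β := fun α β hab hlt =>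
    hc α (le_antisymm (stage_mono F (by simp)) (by
      rw [hab]; exact stage_mono F (Order.add_one_le_of_lt hlt)))
  rcases lt_or_gt_of_ne hne with h | h
  · exact key α β hab h
  · exact key β α hab.symm h

variable (F) in
lemma stage_closureOrdinal : stage F (closureOrdinal F) = stage F (closureOrdinal F + 1) :=
  csInf_mem (s := {α | stage F α = stage F (α + 1)}) (exists_stage_fixed F)

lemma ind_eq_of_fixed {α : Ordinal.{0}} (h : stage F α = stage F (α + 1)) :
    ind F = stage F α := by
  have : closureOrdinal F ≤ α := csInf_le' h
  exact (stage_eq_of_fixed (stage_closureOrdinal F) this).symm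

variable (F) in
lemma apply_ind_le : F (ind F) ≤ ind F := by
  have := stage_closureOrdinal F
  rw [stage_add_one] at this
  exact sup_eq_left.1 this.symm

/-- Invariants of the stages hold for the result of the induction. Together with `apply_ind_le`,
this replaces the computation of the stages in the simple inductions. -/
lemma ind_invariant (P : Cantor → Prop) (h0 : P ⊥) (h1 : ∀ f, P f → P (f ⊔ F f))
    (h2 : ∀ (β : Ordinal.{0}) (s : Set.Iio β → Cantor), (∀ i, P (s i)) → P (⨆ i, s i)) :
    P (ind F) := by
  suffices h : ∀ β : Ordinal.{0}, P (stage F β) from h _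
  intro β
  induction β using Ordinal.limitRecOn with
  | zero => rwa [stage_zero]
  | add_one γ ih => rw [stage_add_one]; exact h1 _ ih
  | limit γ hγ ih => rw [stage_limit F hγ]; exact h2 _ _ fun i => ih i.1 i.2

/-- Every element of a stage entered at an earlier successor step. -/
lemma exists_entry {β : Ordinal.{0}} {x : ℕ} (h : stage F β x = true) :
    ∃ γ < β, stage F γ x = false ∧ stage F (γ + 1) x = true := by
  obtain ⟨δ, hδ, hmin⟩ := WellFounded.has_min (wellFounded_lt (α := Ordinal.{0}))
    {δ | stage F δ x = true} ⟨β, h⟩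
  have hδβ : δ ≤ β := not_lt.1 fun hlt => hmin β h hlt
  induction δ using Ordinal.limitRecOn with
  | zero => simp [stage_zero] at hδ
  | add_one γ ih =>
    refine ⟨γ, (Order.lt_add_one_iff.2 le_rfl).trans_le hδβ, ?_, hδ⟩
    by_contra hc
    exact hmin γ (by simpa using hc) (Order.lt_add_one_iff.2 le_rfl)
  | limit γ hγ ih =>
    simp only [Set.mem_ofPred_eq] at hδ
    rw [stage_limit F hγ, cantor_iSup_apply] at hδ
    obtain ⟨i, hi⟩ := hδ
    exact absurd i.2 (hmin i.1 hi)

/-- A union of successor stages, indexed by natural numbers, is a stage. -/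
lemma exists_stage_eq_union {S : Set ℕ} (β : S → Ordinal.{0}) :
    ∃ γ, ∀ x, stage F γ x = true ↔ ∃ z, stage F (β z + 1) x = true := by
  refine ⟨⨆ z, (β z + 1), fun x => ⟨fun h => ?_, ?_⟩⟩
  · obtain ⟨γ, hγ, -, hx⟩ := exists_entry h
    obtain ⟨z, hz⟩ := (Ordinal.lt_iSup_iff).1 hγ
    exact ⟨z, cantor_le_iff.1 (stage_mono F (Order.add_one_le_of_lt hz)) x hx⟩
  · rintro ⟨z, hz⟩
    exact cantor_le_iff.1 (stage_mono F (Ordinal.le_iSup (fun z => β z + 1) z)) x hz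

end Stage

/-! ### Inductions of partial operators -/

open Classical in
/-- The total operator that agrees with the partial operator `F` where `F` is defined, and is `⊥`
elsewhere. -/
noncomputable def totalize (F : Cantor →. Cantor) (f : Cantor) : Cantor :=
  if h : (F f).Dom then (F f).get h else ⊥

lemma totalize_of_mem {F : Cantor →. Cantor} {f g : Cantor} (h : g ∈ F f) :
    totalize F f = g := by
  rw [totalize, dif_pos h.1]
  exact h.2

/-- The stages of a partial operator are those of its total extension, which links the two notions
of induction. -/
lemma PStage.eq_stage {F : Cantor →. Cantor} {β : Ordinal.{0}} {f : Cantor} (h : PStage F β f) :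
    f = stage (totalize F) β ∧ ∀ γ < β, (F (stage (totalize F) γ)).Dom := by
  induction h with
  | zero => exact ⟨(stage_zero _).symm, fun γ h => absurd h (by simp)⟩
  | succ hf hg ih =>
    obtain ⟨rfl, ih2⟩ := ih
    refine ⟨by rw [stage_add_one, totalize_of_mem hg], fun γ hγ => ?_⟩
    rcases (Order.lt_add_one_iff.1 hγ).eq_or_lt with rfl | h
    · exact hg.1
    · exact ih2 γ h
  | limit hβ s hs hF ih =>
    refine ⟨?_, fun γ hγ => ?_⟩
    · rw [stage_limit _ hβ]
      exact iSup_congr fun γ => (ih γ.1 γ.2).1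
    · rw [← (ih γ hγ).1]
      exact hF γ hγ

lemma PInd.eq_ind {F : Cantor →. Cantor} {A : Cantor} (h : PInd F A) :
    A = ind (totalize F) ∧ ∀ β, (F (stage (totalize F) β)).Dom := by
  obtain ⟨α, h1, h2⟩ := h
  obtain ⟨e1, -⟩ := h1.eq_stage
  obtain ⟨e2, d2⟩ := h2.eq_stage
  have hfix : stage (totalize F) α = stage (totalize F) (α + 1) := e1.symm.trans e2
  refine ⟨e1.trans (ind_eq_of_fixed hfix).symm, fun β => ?_⟩
  rcases le_total α β with h | h
  · rw [stage_eq_of_fixed hfix h]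
    exact d2 _ (Order.lt_add_one_iff.2 le_rfl)
  · exact d2 _ (Order.lt_add_one_iff.2 h)

lemma codedPOp_coe (G : Tp2) (f : Cantor) : codedOp G f ∈ codedPOp (G : (ℕ → ℕ) →. ℕ) f :=
  ⟨fun _ => trivial, rfl⟩

lemma pInd_of_total (G : Tp2) : PInd (codedPOp (G : (ℕ → ℕ) →. ℕ)) (ind (codedOp G)) := by
  have key : ∀ β : Ordinal.{0}, PStage (codedPOp (G : (ℕ → ℕ) →. ℕ)) β (stage (codedOp G) β) := by
    intro β
    induction β using Ordinal.limitRecOn with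
    | zero => rw [stage_zero]; exact .zero
    | add_one γ ih => rw [stage_add_one]; exact .succ ih (codedPOp_coe G _)
    | limit γ hγ ih =>
      rw [stage_limit _ hγ]
      exact .limit hγ _ ih fun δ _ => (codedPOp_coe G _).1
  refine ⟨closureOrdinal (codedOp G), key _, ?_⟩
  have := key (closureOrdinal (codedOp G) + 1)
  rwa [← stage_closureOrdinal] at this

/-- What the definedness of `𝓘 (F_G)` says about `G` on the stages of the total extension of
`F_G`. -/
lemma exists_mem_of_pInd {G : (ℕ → ℕ) →. ℕ} {A : Cantor} (h : PInd (codedPOp G) A)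
    (β : Ordinal.{0}) (n : ℕ) :
    ∃ c ∈ G (concat n (stage (totalize (codedPOp G)) β)),
      (c ≠ 0 ↔ totalize (codedPOp G) (stage (totalize (codedPOp G)) β) n = true) := by
  have hd := h.eq_ind.2 β
  refine ⟨(G _).get (hd n), Part.get_mem _, ?_⟩
  rw [totalize_of_mem (F := codedPOp G) (Part.get_mem hd)]
  simp only [codedPOp, decide_eq_true_eq]
  omega

/-! ### Histories -/

/-- The section `{x | ⟨x, y⟩ ∈ X}` of a set of pairs. -/
def sec (X : Cantor) (y : ℕ) : Cantor := fun x => X (Nat.pair x y)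

/-- `X` is a set of pairs whose sections are meant to be stages of `H`: the section with index `0`
the present one, and the section with index `z + 1` the one at which `z` entered. `Ok H X y` says
that the section `y` is correct, given that all its elements `z` entered at correct sections. -/
inductive Ok (H : Cantor → Cantor) (X : Cantor) : ℕ → Prop
  | mk (y : ℕ) (h₁ : ∀ z, sec X y z = true → Ok H X (z + 1))
      (h₂ : ∀ z, sec X y z = true → H (sec X (z + 1)) z = true)
      (h₃ : ∀ z, sec X y z = true → ∀ x,
        sec X (z + 1) x = true ∨ H (sec X (z + 1)) x = true → sec X y x = true) : Ok H X y

lemma ok_iff {H : Cantor → Cantor} {X : Cantor} {y : ℕ} :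
    Ok H X y ↔ ∀ z, sec X y z = true → Ok H X (z + 1) ∧ H (sec X (z + 1)) z = true ∧
      ∀ x, sec X (z + 1) x = true ∨ H (sec X (z + 1)) x = true → sec X y x = true := by
  constructor
  · rintro ⟨_, h₁, h₂, h₃⟩ z hz
    exact ⟨h₁ z hz, h₂ z hz, h₃ z hz⟩
  · intro h
    exact ⟨y, fun z hz => (h z hz).1, fun z hz => (h z hz).2.1, fun z hz => (h z hz).2.2⟩

/-- `y` is accessible for the relation that puts `z + 1` below `y` when `z` is in the section
`y`. -/
abbrev SecAcc (X : Cantor) (y : ℕ) : Prop :=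
  Acc (fun z' y => ∃ z, z' = z + 1 ∧ sec X y z = true) y

lemma Ok.secAcc {H : Cantor → Cantor} {X : Cantor} {y : ℕ} (h : Ok H X y) : SecAcc X y := by
  induction h with
  | mk y _ _ _ ih =>
    refine ⟨_, ?_⟩
    rintro _ ⟨z, rfl, hz⟩
    exact ih z hz

lemma Ok.exists_stage {H : Cantor → Cantor} {X : Cantor} {y : ℕ} (h : Ok H X y) :
    ∃ β, sec X y = stage H β := by
  induction h with
  | mk y h₁ h₂ h₃ ih =>
    choose! β hβ using ih
    obtain ⟨γ, hγ⟩ := exists_stage_eq_union (F := H) (S := {z | sec X y z = true}) fun z => β z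
    refine ⟨γ, cantor_ext fun x => ?_⟩
    rw [hγ]
    constructor
    · intro hx
      refine ⟨⟨x, hx⟩, ?_⟩
      rw [stage_add_one, cantor_sup_apply, ← hβ x hx]
      exact Or.inr (h₂ x hx)
    · rintro ⟨⟨z, hz⟩, hx⟩
      rw [stage_add_one, cantor_sup_apply, ← hβ z hz] at hx
      exact h₃ z hz x hx

/-- The characteristic function of the history of the induction over `H` at `β`. -/
noncomputable def hist (H : Cantor → Cantor) (β : Ordinal.{0}) : Cantor := by
  classical exact fun k =>
    if k.unpair.2 = 0 then stage H β k.unpair.1 else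
      decide (∃ γ < β, stage H γ (k.unpair.2 - 1) = false ∧
        stage H (γ + 1) (k.unpair.2 - 1) = true ∧ stage H γ k.unpair.1 = true)

section Hist

variable {H : Cantor → Cantor} {β : Ordinal.{0}}

lemma sec_hist_zero : sec (hist H β) 0 = stage H β := by
  funext x
  simp [sec, hist]

lemma sec_hist_succ {b x : ℕ} : sec (hist H β) (b + 1) x = true ↔
    ∃ γ < β, stage H γ b = false ∧ stage H (γ + 1) b = true ∧ stage H γ x = true := by
  simp [sec, hist]

lemma sec_hist_succ_eq {b : ℕ} {γ : Ordinal.{0}} (hγ : γ < β) (h1 : stage H γ b = false)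
    (h2 : stage H (γ + 1) b = true) : sec (hist H β) (b + 1) = stage H γ := by
  refine cantor_ext fun x => ?_
  rw [sec_hist_succ]
  constructor
  · rintro ⟨δ, -, h3, h4, hx⟩
    refine cantor_le_iff.1 (stage_mono H ?_) x hx
    by_contra hlt
    have := cantor_le_iff.1 (stage_mono H (Order.add_one_le_of_lt (not_le.1 hlt))) b h2
    simp [h3] at this
  · exact fun hx => ⟨γ, hγ, h1, h2, hx⟩

lemma ok_hist_zero : Ok H (hist H β) 0 := by
  have key : ∀ γ ≤ β, ∀ y, sec (hist H β) y = stage H γ → Ok H (hist H β) y := by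
    intro γ
    induction γ using WellFoundedLT.induction with
    | ind γ ih =>
      intro hγ y hy
      refine ok_iff.2 fun z hz => ?_
      rw [hy] at hz
      obtain ⟨δ, hδ, h1, h2⟩ := exists_entry hz
      have e := sec_hist_succ_eq (hδ.trans_le hγ) h1 h2
      refine ⟨ih δ hδ (hδ.le.trans hγ) _ e, ?_, fun x hx => ?_⟩
      · rw [stage_add_one, cantor_sup_apply, h1] at h2
        rw [e]
        simpa using h2
      · rw [e, ← cantor_sup_apply, ← stage_add_one] at hx
        rw [hy]
        exact cantor_le_iff.1 (stage_mono H (Order.add_one_le_of_lt hδ)) x hx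
  exact key β le_rfl 0 sec_hist_zero

/-- One step of the induction that builds up the history of the induction over `H`: the sections
that are added to the history `X` are determined by `H (sec X 0)`. -/
def HistStep (H : Cantor → Cantor) (X : Cantor) (k : ℕ) : Prop :=
  Ok H X 0 ∧ ((k.unpair.2 = 0 ∧ H (sec X 0) k.unpair.1 = true) ∨
    (k.unpair.2 ≠ 0 ∧ sec X 0 (k.unpair.2 - 1) = false ∧ sec X 0 k.unpair.1 = true ∧
      H (sec X 0) (k.unpair.2 - 1) = true))

/-- The stages of the history induction are the histories. -/
lemma stage_histStep {Γ : Cantor → Cantor} (hΓ : ∀ X k, Γ X k = true ↔ HistStep H X k)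
    (β : Ordinal.{0}) : stage Γ β = hist H β := by
  have hext : ∀ f g : Cantor, (∀ x, sec f 0 x = true ↔ sec g 0 x = true) →
      (∀ b x, sec f (b + 1) x = true ↔ sec g (b + 1) x = true) → f = g := by
    intro f g h0 h1
    refine cantor_ext fun k => ?_
    rw [← Nat.pair_unpair k]
    rcases k.unpair.2 with _ | b
    · exact h0 _
    · exact h1 _ _
  induction β using Ordinal.limitRecOn with
  | zero =>
    rw [stage_zero]
    refine hext _ _ (fun x => ?_) fun b x => ?_
    · rw [sec_hist_zero, stage_zero]; simp [sec]
    · rw [sec_hist_succ]; simp [sec]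
  | add_one β ih =>
    rw [stage_add_one, ih]
    refine hext _ _ (fun x => ?_) fun b x => ?_
    · have : sec (Γ (hist H β)) 0 x = true ↔ H (stage H β) x = true := by
        rw [sec, hΓ, HistStep]
        simp [ok_hist_zero, sec_hist_zero]
      rw [sec_hist_zero, stage_add_one, cantor_sup_apply, ← this]
      conv_rhs => rw [← sec_hist_zero]
      exact cantor_sup_apply _ _ _
    · have : sec (Γ (hist H β)) (b + 1) x = true ↔ stage H β b = false ∧ stage H β x = true ∧
          H (stage H β) b = true := by
        rw [sec, hΓ, HistStep]
        simp [ok_hist_zero, sec_hist_zero]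
      have h2 : sec (hist H β ⊔ Γ (hist H β)) (b + 1) x = true ↔
        sec (hist H β) (b + 1) x = true ∨ sec (Γ (hist H β)) (b + 1) x = true :=
          cantor_sup_apply _ _ _
      rw [h2, this, sec_hist_succ, sec_hist_succ]
      constructor
      · rintro (⟨γ, hγ, h⟩ | ⟨h1, h2, h3⟩)
        · exact ⟨γ, hγ.trans (Order.lt_add_one_iff.2 le_rfl), h⟩
        · refine ⟨β, Order.lt_add_one_iff.2 le_rfl, h1, ?_, h2⟩
          rw [stage_add_one, cantor_sup_apply]
          exact Or.inr h3
      · rintro ⟨γ, hγ, h⟩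
        rcases (Order.lt_add_one_iff.1 hγ).eq_or_lt with rfl | hlt
        · refine Or.inr ⟨h.1, h.2.2, ?_⟩
          have := h.2.1
          rw [stage_add_one, cantor_sup_apply, h.1] at this
          simpa using this
        · exact Or.inl ⟨γ, hlt, h⟩
  | limit β hβ ih =>
    rw [stage_limit _ hβ]
    have hs : ∀ y x, sec (⨆ γ : Set.Iio β, stage Γ γ.1) y x = true ↔
        ∃ γ : Set.Iio β, sec (hist H γ.1) y x = true := by
      intro y x
      rw [sec, cantor_iSup_apply]
      exact exists_congr fun γ => by rw [ih γ.1 γ.2]; rfl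
    refine hext _ _ (fun x => ?_) fun b x => ?_
    · rw [hs, sec_hist_zero, stage_limit _ hβ, cantor_iSup_apply]
      simp only [sec_hist_zero]
    · rw [hs, sec_hist_succ]
      simp only [sec_hist_succ]
      constructor
      · rintro ⟨γ, δ, hδ, h⟩
        exact ⟨δ, hδ.trans γ.2, h⟩
      · rintro ⟨δ, hδ, h⟩
        exact ⟨⟨δ + 1, hβ.add_one_lt hδ⟩, δ, Order.lt_add_one_iff.2 le_rfl, h⟩

/-- The induction over `H` can be read off from the induction that builds up its history. -/
lemma ind_histStep {Γ : Cantor → Cantor} (hΓ : ∀ X k, Γ X k = true ↔ HistStep H X k) (b : ℕ) :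
    ind Γ (Nat.pair b 0) = ind H b := by
  have h := stage_closureOrdinal Γ
  have hfix : stage H (closureOrdinal Γ) = stage H (closureOrdinal Γ + 1) := by
    rw [stage_histStep hΓ, stage_histStep hΓ] at h
    rw [← sec_hist_zero, h, sec_hist_zero]
  rw [ind_eq_of_fixed hfix, ind, stage_histStep hΓ, ← sec_hist_zero]
  rfl

end Hist

/-! ### Elementary indices -/

lemma getElem?_filterMap_getElem? {α : Type} (l : List α) (t : List ℕ)
    (h : ∀ i ∈ t, i < l.length) (k : ℕ) :
    (t.filterMap (fun i => l[i]?))[k]? = t[k]?.bind (fun i => l[i]?) := by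
  induction t generalizing k with
  | nil => simp
  | cons i t ih =>
    have hi : i < l.length := h i (by simp)
    rw [List.filterMap_cons_some (List.getElem?_eq_getElem hi)]
    cases k with
    | zero => simp [hi]
    | succ k => simpa using ih (fun j hj => h j (by simp [hj])) k

/-- The entries of `permuted t l`, through the extension of the list `t` to all indices. -/
lemma getElem?_permuted {α : Type} {t : List ℕ} {l : List α} (h : PermCode t l) (k : ℕ) :
    (permuted t l)[k]? = l[t.getD k k]? := by
  have ht : ∀ i ∈ t, i < l.length := fun i hi =>
    (List.mem_range.1 (h.1.mem_iff.1 hi)).trans_le h.2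
  have hlen : (t.filterMap (fun i => l[i]?)).length = t.length := by
    have key := getElem?_filterMap_getElem? l t ht
    refine le_antisymm (List.length_filterMap_le _ _) (not_lt.1 fun hlt => ?_)
    have h1 := key (t.filterMap (fun i => l[i]?)).length
    rw [List.getElem?_eq_none le_rfl, List.getElem?_eq_getElem hlt, Option.bind_some,
      List.getElem?_eq_getElem (ht _ (List.getElem_mem _))] at h1
    simp at h1
  rw [permuted]
  rcases lt_or_ge k t.length with hk | hk
  · rw [List.getElem?_append_left (by omega), getElem?_filterMap_getElem? l t ht]
    simp [hk]
  · rw [List.getElem?_append_right (by omega), hlen, List.getElem?_drop]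
    have : t.getD k k = k := by simp [List.getElem?_eq_none hk]
    rw [this]
    congr 1
    omega

lemma permuted_nil {α : Type} (l : List α) : permuted [] l = l := by simp [permuted]

lemma permCode_nil {α : Type} (l : List α) : PermCode [] l := ⟨by simp, by simp⟩

/-- The list of values of the transposition of `0` and `i`. -/
def swapList (i : ℕ) : List ℕ :=
  (List.range (i + 1)).map fun x => if x = 0 then i else if x = i then 0 else x

lemma getD_swapList (i k : ℕ) : (swapList i).getD k k = Equiv.swap 0 i k := by
  rw [Equiv.swap_apply_def, swapList]
  rcases lt_or_ge k (i + 1) with h | h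
  · simp [h]
  · have h0 : k ≠ 0 := by omega
    have h1 : k ≠ i := by omega
    simp [h0, h1, List.getElem?_eq_none, h]

lemma permCode_swapList {α : Type} {i : ℕ} {l : List α} (h : i < l.length) :
    PermCode (swapList i) l := by
  have hlen : (swapList i).length = i + 1 := by simp [swapList]
  refine ⟨?_, by omega⟩
  rw [hlen]
  refine (List.perm_ext_iff_of_nodup ?_ List.nodup_range).2 fun x => ?_
  · refine List.Nodup.map_on ?_ List.nodup_range
    intro x _ y _ hxy
    split_ifs at hxy <;> omega
  · simp only [swapList, List.mem_map, List.mem_range]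
    constructor
    · rintro ⟨y, hy, rfl⟩
      split_ifs <;> omega
    · intro hx
      refine ⟨if x = 0 then i else if x = i then 0 else x, ?_, ?_⟩
      · split_ifs <;> omega
      · split_ifs <;> omega

lemma getElem?_permuted_swapList {α : Type} {i : ℕ} {l : List α} (h : i < l.length) (k : ℕ) :
    (permuted (swapList i) l)[k]? = l[Equiv.swap 0 i k]? := by
  rw [getElem?_permuted (permCode_swapList h), getD_swapList]

lemma permuted_swapList_eq_cons {α : Type} {i : ℕ} {l : List α} {a : α} (h : l[i]? = some a) :
    ∃ l', permuted (swapList i) l = a :: l' := by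
  have hi : i < l.length := (List.getElem?_eq_some_iff.1 h).1
  have h0 := getElem?_permuted_swapList hi 0
  rw [Equiv.swap_apply_left, h] at h0
  cases hp : permuted (swapList i) l with
  | nil => simp [hp] at h0
  | cons b l' =>
    rw [hp] at h0
    simp only [List.getElem?_cons_zero, Option.some.injEq] at h0
    exact ⟨l', by rw [h0]⟩

lemma length_permuted {α : Type} {t : List ℕ} {l : List α} (h : PermCode t l) :
    (permuted t l).length = l.length := by
  have h1 : (permuted t l)[l.length]? = none := by
    rw [getElem?_permuted h]
    refine List.getElem?_eq_none ?_
    rw [List.getD_eq_default _ _ h.2]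
  refine le_antisymm (List.getElem?_eq_none_iff.1 h1) (not_lt.1 fun hlt => ?_)
  have h2 := getElem?_permuted h (permuted t l).length
  rw [List.getElem?_eq_none le_rfl, eq_comm, List.getElem?_eq_none_iff] at h2
  rcases lt_or_ge (permuted t l).length t.length with h3 | h3
  · rw [List.getD_eq_getElem _ _ h3] at h2
    have := List.mem_range.1 (h.1.mem_iff.1 (List.getElem_mem h3))
    have := h.2
    omega
  · rw [List.getD_eq_default _ _ h3] at h2
    omega

lemma permuted_swapList_permuted_swapList {α : Type} {i : ℕ} {l : List α} (h : i < l.length) :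
    permuted (swapList i) (permuted (swapList i) l) = l := by
  refine List.ext_getElem? fun k => ?_
  have h' : i < (permuted (swapList i) l).length := by
    rwa [length_permuted (permCode_swapList h)]
  rw [getElem?_permuted_swapList h', getElem?_permuted_swapList h, Equiv.swap_apply_self]

/-- The index of the constant `q`. -/
def kst (q : ℕ) : ℕ := seqNum [2, q]

/-- The index that evaluates `e₂`, puts the value in front of the number arguments, and then
evaluates `e₁`. -/
def cmp (e₁ e₂ : ℕ) : ℕ := seqNum [4, e₁, e₂]

/-- The index of the successor of the first number argument. -/
def sidx : ℕ := seqNum [1]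

/-- The index of universal evaluation: the first number argument is the index to evaluate. -/
def uidx : ℕ := seqNum [9]

/-- The index of the number argument at position `p`. -/
def arg (p : ℕ) : ℕ := seqNum [6, seqNum [3], seqNum [], seqNum [], seqNum (swapList p)]

/-- The index that applies the function argument at position `q` to the first number argument. -/
def app (q : ℕ) : ℕ := seqNum [6, seqNum [7], seqNum [], seqNum (swapList q), seqNum []]

/-- The index that applies `𝓘` to the functional with index `d`. -/
def iidx (d : ℕ) : ℕ := seqNum [8, 3, d]

section

variable {Fs : List Tp2} {fs : List (ℕ → ℕ)} {as : List ℕ}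

lemma tcomp_kst (q : ℕ) : TComp (kst q) Fs fs as q := Kleene.s2 rfl

lemma tcomp_cmp {e₁ e₂ b c : ℕ} (h₂ : TComp e₂ Fs fs as b) (h₁ : TComp e₁ Fs fs (b :: as) c) :
    TComp (cmp e₁ e₂) Fs fs as c := Kleene.s4 rfl h₂ h₁

lemma tcomp_sidx {a : ℕ} : TComp sidx Fs fs (a :: as) (a + 1) := Kleene.s1 rfl

lemma tcomp_uidx {d c : ℕ} (h : TComp d Fs fs as c) : TComp uidx Fs fs (d :: as) c :=
  Kleene.s9 rfl h

lemma tcomp_arg {p a : ℕ} (h : as[p]? = some a) : TComp (arg p) Fs fs as a := by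
  obtain ⟨l', hl⟩ := permuted_swapList_eq_cons h
  refine Kleene.s6 rfl (permCode_nil _) (permCode_nil _)
    (permCode_swapList (List.getElem?_eq_some_iff.1 h).1) ?_
  rw [hl]
  exact Kleene.s3 rfl

lemma tcomp_app {q a : ℕ} {f : ℕ → ℕ} (h : fs[q]? = some f) :
    TComp (app q) Fs fs (a :: as) (f a) := by
  obtain ⟨l', hl⟩ := permuted_swapList_eq_cons h
  refine Kleene.s6 rfl (permCode_nil _)
    (permCode_swapList (List.getElem?_eq_some_iff.1 h).1) (permCode_nil _) ?_
  rw [hl, permuted_nil]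
  exact Kleene.s7 rfl

lemma tcomp_iidx {d : ℕ} (G : Tp2) (h : ∀ f, TComp d Fs (f :: fs) as (G f)) (b : ℕ) :
    TComp (iidx d) Fs fs (b :: as) (ind (codedOp G) b).toNat := by
  refine Kleene.s8_3 rfl (G : (ℕ → ℕ) →. ℕ) (fun f c hc => ?_) _ ⟨G, rfl, rfl⟩
  have : c = G f := by simpa using hc
  rw [this]
  exact h f

/-- The index `e` decides `P`: its value is nonzero if `P` holds, and zero otherwise. -/
def TB (e : ℕ) (Fs : List Tp2) (fs : List (ℕ → ℕ)) (as : List ℕ) (P : Prop) : Prop :=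
  ∃ v, TComp e Fs fs as v ∧ (v ≠ 0 ↔ P)

lemma TB.congr {e : ℕ} {P Q : Prop} (h : TB e Fs fs as P) (hPQ : P ↔ Q) : TB e Fs fs as Q := by
  obtain ⟨v, h1, h2⟩ := h
  exact ⟨v, h1, h2.trans hPQ⟩

lemma tb_kst_zero : TB (kst 0) Fs fs as False := ⟨0, tcomp_kst 0, by simp⟩

lemma tb_kst_one : TB (kst 1) Fs fs as True := ⟨1, tcomp_kst 1, by simp⟩

open Classical in
/-- S8 for a functional of which only the truth value matters. -/
lemma tcomp_iidx_of_tb {d : ℕ} {Q : (ℕ → ℕ) → Prop} (h : ∀ g, TB d Fs (g :: fs) as (Q g))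
    (b : ℕ) :
    TComp (iidx d) Fs fs (b :: as) (ind (fun f n => decide (Q (concat n f))) b).toNat := by
  choose G hG hQ using h
  have : (fun f n => decide (Q (concat n f))) = codedOp G := by
    funext f n
    rw [codedOp, decide_eq_decide, ← hQ]
    omega
  rw [this]
  exact tcomp_iidx G hG b

lemma tb_iidx {d : ℕ} {Q : (ℕ → ℕ) → Prop} (h : ∀ g, TB d Fs (g :: fs) as (Q g))
    {Γ : Cantor → Cantor} (hΓ : ∀ f n, Γ f n = true ↔ Q (concat n f)) (b : ℕ) :
    TB (iidx d) Fs fs (b :: as) (ind Γ b = true) := by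
  classical
  have : Γ = fun f n => decide (Q (concat n f)) := by
    funext f n
    exact Bool.eq_iff_iff.2 (by simp [hΓ])
  rw [this]
  refine ⟨_, tcomp_iidx_of_tb h b, ?_⟩
  cases ind (fun f n => decide (Q (concat n f))) b <;> simp

end

/-! ### Sign, branching and comparison -/

/-- The index of the sign of the first number argument: an induction over a constant operator. -/
def sgIdx : ℕ := cmp (iidx (seqNum [3])) (kst 0)

lemma tcomp_sgIdx {Fs : List Tp2} {fs : List (ℕ → ℕ)} {a : ℕ} {as : List ℕ} :
    TComp sgIdx Fs fs (a :: as) (if a = 0 then 0 else 1) := by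
  refine tcomp_cmp (tcomp_kst 0) ?_
  have h := tcomp_iidx (Fs := Fs) (fs := fs) (as := a :: as) (d := seqNum [3]) (fun _ => a)
    (fun f => Kleene.s3 rfl) 0
  convert h using 1
  set F := codedOp fun _ => a
  have hF : ∀ f n, F f n = true ↔ a ≠ 0 := fun f n => by
    simp only [F, codedOp, decide_eq_true_eq]; omega
  by_cases ha : a = 0
  · have : ind F = ⊥ := by
      refine ind_invariant (· = ⊥) rfl ?_ ?_
      · rintro _ rfl
        refine cantor_ext fun n => ?_
        rw [cantor_sup_apply, hF]
        simp [ha]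
      · intro β s hs
        simp only [hs, iSup_bot]
    rw [this]
    simp [ha]
  · have := cantor_le_iff.1 (apply_ind_le F) 0 ((hF _ _).2 ha)
    rw [this]
    simp [ha]

/-- The index that adds `k` to the value of `e`. -/
def addIdx (k e : ℕ) : ℕ := (cmp sidx)^[k] e

lemma tcomp_addIdx {Fs : List Tp2} {fs : List (ℕ → ℕ)} {as : List ℕ} {e v : ℕ} (k : ℕ)
    (h : TComp e Fs fs as v) : TComp (addIdx k e) Fs fs as (v + k) := by
  induction k with
  | zero => exact h
  | succ k ih =>
    rw [addIdx, Function.iterate_succ_apply']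
    exact tcomp_cmp ih tcomp_sidx

/-- An index with the same values as `e`, and larger than `e`. -/
def pad (e : ℕ) : ℕ := seqNum [6, e, seqNum [], seqNum [], seqNum []]

lemma tcomp_pad {Fs : List Tp2} {fs : List (ℕ → ℕ)} {as : List ℕ} {e v : ℕ}
    (h : TComp e Fs fs as v) : TComp (pad e) Fs fs as v :=
  Kleene.s6 rfl (permCode_nil _) (permCode_nil _) (permCode_nil _) (by simpa [permuted_nil])

lemma lt_pad (e : ℕ) : e < pad e := by
  rw [pad, seqNum, Encodable.encode_list_cons, Encodable.encode_list_cons]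
  have h1 := Nat.right_le_pair (Encodable.encode 6) ((Nat.pair (Encodable.encode e)
    (Encodable.encode [seqNum [], seqNum [], seqNum []])).succ)
  have h2 := Nat.left_le_pair (Encodable.encode e)
    (Encodable.encode [seqNum [], seqNum [], seqNum []])
  simp only [Encodable.encode_nat] at *
  omega

/-- Definition by cases between two fixed indices. The adjacent numbers `12` and `13` are the
indices `⟨2, 1⟩` of the constant `1` and `⟨3⟩` of the first argument. So universal evaluation of
`12` plus the sign of `a` at a number `x` gives `1` or `x`, which by addition of a constant becomes
one of two given indices. -/
lemma exists_branch (e₀ e₁ : ℕ) : ∃ e, ∀ (Fs : List Tp2) (fs : List (ℕ → ℕ)) (a : ℕ) (as : List ℕ)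
    (c : ℕ), (a = 0 → TComp e₀ Fs fs (a :: as) c) → (a ≠ 0 → TComp e₁ Fs fs (a :: as) c) →
      TComp e Fs fs (a :: as) c := by
  obtain ⟨k, hk⟩ : ∃ k, pad e₀ = 1 + k := ⟨pad e₀ - 1, by have := lt_pad e₀; omega⟩
  have hpad : ∀ m, m ≤ pad^[m] e₁ := by
    intro m
    induction m with
    | zero => exact Nat.zero_le _
    | succ m ih =>
      rw [Function.iterate_succ_apply']
      exact (Nat.succ_le_succ ih).trans (lt_pad _)
  -- padding makes `e₁` large enough for both indices to be reached by adding the same `k`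
  obtain ⟨x, hx⟩ : ∃ x, pad^[k] e₁ = x + k := ⟨pad^[k] e₁ - k, by have := hpad k; omega⟩
  refine ⟨cmp uidx (addIdx k (cmp (cmp uidx (addIdx 12 (cmp sgIdx (arg 1)))) (kst x))),
    fun Fs fs a as c h0 h1 => ?_⟩
  have h12 : 12 = seqNum [2, 1] := by decide
  have h13 : 13 = seqNum [3] := by decide
  have hs : TComp (addIdx 12 (cmp sgIdx (arg 1))) Fs fs (x :: a :: as)
      ((if a = 0 then 0 else 1) + 12) :=
    tcomp_addIdx 12 (tcomp_cmp (tcomp_arg (a := a) (by simp)) tcomp_sgIdx)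
  by_cases ha : a = 0
  · rw [if_pos ha] at hs
    have h := tcomp_addIdx k (tcomp_cmp (tcomp_kst x) (tcomp_cmp hs (tcomp_uidx (c := 1)
      (Kleene.s2 h12))))
    rw [← hk] at h
    exact tcomp_cmp h (tcomp_uidx (tcomp_pad (h0 ha)))
  · rw [if_neg ha] at hs
    have h := tcomp_addIdx k (tcomp_cmp (tcomp_kst x) (tcomp_cmp hs (tcomp_uidx (c := x)
      (Kleene.s3 h13))))
    rw [← hx] at h
    refine tcomp_cmp h (tcomp_uidx ?_)
    have : ∀ m, TComp (pad^[m] e₁) Fs fs (a :: as) c := by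
      intro m
      induction m with
      | zero => exact h1 ha
      | succ m ih =>
        rw [Function.iterate_succ_apply']
        exact tcomp_pad ih
    exact this k

/-- The index that branches to `e₀` or `e₁`, according to whether the first number argument is
zero. -/
noncomputable def branch (e₀ e₁ : ℕ) : ℕ := (exists_branch e₀ e₁).choose

lemma tcomp_branch {e₀ e₁ : ℕ} {Fs : List Tp2} {fs : List (ℕ → ℕ)} {a : ℕ} {as : List ℕ} {c : ℕ}
    (h₀ : a = 0 → TComp e₀ Fs fs (a :: as) c) (h₁ : a ≠ 0 → TComp e₁ Fs fs (a :: as) c) :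
    TComp (branch e₀ e₁) Fs fs (a :: as) c :=
  (exists_branch e₀ e₁).choose_spec Fs fs a as c h₀ h₁

lemma tb_branch {e₀ e₁ : ℕ} {Fs : List Tp2} {fs : List (ℕ → ℕ)} {a : ℕ} {as : List ℕ} {P : Prop}
    (h₀ : a = 0 → TB e₀ Fs fs (a :: as) P) (h₁ : a ≠ 0 → TB e₁ Fs fs (a :: as) P) :
    TB (branch e₀ e₁) Fs fs (a :: as) P := by
  by_cases ha : a = 0
  · obtain ⟨v, h1, h2⟩ := h₀ ha
    exact ⟨v, tcomp_branch (fun _ => h1) (fun h => absurd ha h), h2⟩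
  · obtain ⟨v, h1, h2⟩ := h₁ ha
    exact ⟨v, tcomp_branch (fun h => absurd h ha) (fun _ => h1), h2⟩

/-- The index of the relation `n < a`, for `n` and `a` the first two number arguments. It is an
induction whose stages are the initial segments of `{0, …, a - 1}`: the predecessor is available
because `(n ⌢ f) (n) = f (n - 1)`. -/
noncomputable def ltIdx : ℕ :=
  iidx (branch (kst 0) (cmp (branch (cmp (branch (kst 1) (app 0)) (cmp (app 0) (kst 0))) (kst 0))
    (app 0)))

lemma tb_ltIdx {Fs : List Tp2} {fs : List (ℕ → ℕ)} {n a : ℕ} {as : List ℕ} :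
    TB ltIdx Fs fs (n :: a :: as) (n < a) := by
  classical
  set Q : (ℕ → ℕ) → Prop := fun g => a ≠ 0 ∧ g a = 0 ∧ (g 0 = 0 ∨ g (g 0) ≠ 0) with hQ
  have key : ∀ g : ℕ → ℕ, TB (branch (kst 0) (cmp (branch (cmp (branch (kst 1) (app 0))
      (cmp (app 0) (kst 0))) (kst 0)) (app 0))) Fs (g :: fs) (a :: as) (Q g) := by
    intro g
    refine tb_branch (fun ha => tb_kst_zero.congr (by simp [hQ, ha])) fun ha => ?_
    suffices h : TB (branch (cmp (branch (kst 1) (app 0)) (cmp (app 0) (kst 0))) (kst 0)) Fs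
        (g :: fs) (g a :: a :: as) (Q g) by
      obtain ⟨v, h1, h2⟩ := h
      exact ⟨v, tcomp_cmp (tcomp_app rfl) h1, h2⟩
    refine tb_branch (fun h => ?_) (fun h => tb_kst_zero.congr (by simp [hQ, h]))
    suffices h' : TB (branch (kst 1) (app 0)) Fs (g :: fs) (g 0 :: g a :: a :: as) (Q g) by
      obtain ⟨v, h1, h2⟩ := h'
      exact ⟨v, tcomp_cmp (tcomp_cmp (tcomp_kst 0) (tcomp_app rfl)) h1, h2⟩
    refine tb_branch (fun h1 => tb_kst_one.congr (by simp [hQ, h, h1, ha])) fun h1 => ?_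
    exact ⟨_, tcomp_app rfl, by simp [hQ, h, h1, ha]⟩
  refine (tb_iidx key (Γ := fun f n => decide (Q (concat n f))) (by simp) n).congr ?_
  set Γ : Cantor → Cantor := fun f n => decide (Q (concat n f)) with hΓ
  have happ : ∀ f n, Γ f n = true ↔
      a ≠ 0 ∧ f (a - 1) = false ∧ (n = 0 ∨ f (n - 1) = true) := by
    intro f n
    simp only [hΓ, hQ, decide_eq_true_eq]
    rcases a with _ | a
    · simp
    · rcases n with _ | n <;> simp [concat]
  have hinv : (∀ m, ind Γ (m + 1) = true → ind Γ m = true) ∧ ∀ m, ind Γ m = true → m < a := by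
    refine ind_invariant (fun f => (∀ m, f (m + 1) = true → f m = true) ∧ ∀ m, f m = true → m < a)
      (by simp) ?_ ?_
    · rintro f ⟨h1, h2⟩
      have hd : ∀ m k, f (m + k) = true → f m = true := by
        intro m k
        induction k with
        | zero => exact id
        | succ k ih => exact fun h => ih (h1 _ h)
      refine ⟨fun m hm => ?_, fun m hm => ?_⟩
      · rw [cantor_sup_apply, happ] at hm ⊢
        rcases hm with hm | ⟨-, -, hm⟩
        · exact Or.inl (h1 m hm)
        · exact Or.inl (by simpa using hm)
      · rw [cantor_sup_apply, happ] at hm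
        rcases hm with hm | ⟨ha, hfa, hm⟩
        · exact h2 m hm
        · by_contra hlt
          rcases hm with rfl | hm
          · omega
          · have := hd (a - 1) (m - 1 - (a - 1)) (by
              rwa [show a - 1 + (m - 1 - (a - 1)) = m - 1 by omega])
            simp [this] at hfa
    · intro β s hs
      refine ⟨fun m hm => ?_, fun m hm => ?_⟩
      · rw [cantor_iSup_apply] at hm ⊢
        obtain ⟨i, hi⟩ := hm
        exact ⟨i, (hs i).1 m hi⟩
      · rw [cantor_iSup_apply] at hm
        obtain ⟨i, hi⟩ := hm
        exact (hs i).2 m hi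
  refine ⟨hinv.2 n, fun hn => ?_⟩
  have hcl := cantor_le_iff.1 (apply_ind_le Γ)
  have htop : ind Γ (a - 1) = true := by
    by_contra hc
    have hall : ∀ m, ind Γ m = true := by
      intro m
      induction m with
      | zero => exact hcl 0 ((happ _ _).2 ⟨by omega, by simpa using hc, Or.inl rfl⟩)
      | succ m ih => exact hcl _ ((happ _ _).2 ⟨by omega, by simpa using hc, Or.inr ih⟩)
    exact hc (hall _)
  have hd : ∀ k m, ind Γ (m + k) = true → ind Γ m = true := by
    intro k
    induction k with
    | zero => exact fun m => id
    | succ k ih => exact fun m h => ih m (hinv.1 _ h)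
  exact hd (a - 1 - n) n (by rwa [show n + (a - 1 - n) = a - 1 by omega])

/-! ### Primitive recursive functions -/

/-- The index that puts copies of the number arguments at the positions `ps` in front of the number
arguments, and then evaluates `e`. -/
def pushArgs : ℕ → List ℕ → ℕ
  | e, [] => e
  | e, p :: ps => pushArgs (cmp e (arg (p + ps.length))) ps

lemma tcomp_pushArgs {Fs : List Tp2} {fs : List (ℕ → ℕ)} {l : List ℕ} {ps xs : List ℕ}
    (h : List.Forall₂ (fun p x => l[p]? = some x) ps xs) {e c : ℕ}
    (he : TComp e Fs fs (xs ++ l) c) : TComp (pushArgs e ps) Fs fs l c := by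
  induction h generalizing e with
  | nil => exact he
  | @cons p x ps xs hp h ih =>
    refine ih (tcomp_cmp (tcomp_arg (a := x) ?_) he)
    rw [List.getElem?_append_right (by rw [h.length_eq]; omega), ← hp, h.length_eq]
    congr 1
    omega

lemma forall₂_range' (l₁ v l₂ : List ℕ) :
    List.Forall₂ (fun p x => (l₁ ++ (v ++ l₂))[p]? = some x)
      (List.range' l₁.length v.length) v := by
  induction v generalizing l₁ with
  | nil => exact .nil
  | cons x v ih =>
    refine .cons (by simp) ?_
    have := ih (l₁ ++ [x])
    simpa using this

/-- The index that evaluates the indices `gs`, all at the first `m` number arguments, puts the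
values in front of the number arguments, and then evaluates `e`. -/
def pushEvals (m : ℕ) : ℕ → List ℕ → ℕ
  | e, [] => e
  | e, g :: gs => pushEvals m (cmp e (pushArgs g (List.range' gs.length m))) gs

lemma tcomp_pushEvals {Fs : List Tp2} {fs : List (ℕ → ℕ)} {v as : List ℕ} {gs xs : List ℕ}
    (h : List.Forall₂ (fun g x => ∀ as, TComp g Fs fs (v ++ as) x) gs xs) {e c : ℕ}
    (he : TComp e Fs fs (xs ++ (v ++ as)) c) :
    TComp (pushEvals v.length e gs) Fs fs (v ++ as) c := by
  induction h generalizing e with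
  | nil => exact he
  | @cons g x gs xs hg h ih =>
    refine ih (tcomp_cmp (b := x) ?_ he)
    rw [h.length_eq]
    exact tcomp_pushArgs (forall₂_range' xs v as) (hg _)

/-- The body of primitive recursion with step `g` and `m` parameters. The number arguments are an
index `p` (which is to be the index of this body), a counter `i`, the value at `i`, the bound
`n`, and the parameters. -/
noncomputable def recBody (m g : ℕ) : ℕ :=
  cmp (branch (arg 3)
    (pushArgs (cmp (cmp (cmp (cmp uidx (arg 0)) (arg (m + 4))) (cmp sidx (arg (m + 4))))
      (pushArgs g ((m + 3) :: (m + 4) :: List.range' 1 m))) (4 :: List.range' 5 m)))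
    (pushArgs ltIdx [1, 3])

/-- The loop of primitive recursion, started at `i` with `φ i`, ends at `n = i + j` with `φ n`. -/
lemma tcomp_recBody {Fs : List Tp2} {fs : List (ℕ → ℕ)} {v : List ℕ} {g : ℕ} {φ : ℕ → ℕ}
    (hg : ∀ i as, TComp g Fs fs (i :: φ i :: (v ++ as)) (φ (i + 1))) (n : ℕ) (j i : ℕ)
    (hij : i + j = n) (as : List ℕ) :
    TComp (recBody v.length g) Fs fs (recBody v.length g :: i :: φ i :: n :: (v ++ as)) (φ n) := by
  induction j generalizing i as with
  | zero =>
    obtain ⟨t, ht, ht'⟩ := tb_ltIdx (Fs := Fs) (fs := fs) (n := i) (a := n)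
      (as := recBody v.length g :: i :: φ i :: n :: (v ++ as))
    have h0 : t = 0 := by
      by_contra hc
      have := ht'.1 hc
      omega
    rw [show φ n = φ i by rw [← hij]; rfl]
    exact tcomp_cmp (tcomp_pushArgs (.cons rfl (.cons rfl .nil)) ht)
      (tcomp_branch (fun _ => tcomp_arg rfl) fun h => absurd h0 h)
  | succ j ih =>
    obtain ⟨t, ht, ht'⟩ := tb_ltIdx (Fs := Fs) (fs := fs) (n := i) (a := n)
      (as := recBody v.length g :: i :: φ i :: n :: (v ++ as))
    have h0 : t ≠ 0 := ht'.2 (by omega)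
    refine tcomp_cmp (tcomp_pushArgs (.cons rfl (.cons rfl .nil)) ht)
      (tcomp_branch (fun h => absurd h h0) fun _ => ?_)
    refine tcomp_pushArgs (xs := n :: v) (.cons rfl ?_) ?_
    · exact forall₂_range' [t, recBody v.length g, i, φ i, n] v as
    · have hpos : ∀ (l₁ l₂ : List ℕ) (k : ℕ),
          (l₁ ++ (v ++ l₂))[l₁.length + v.length + k]? = l₂[k]? := by
        intro l₁ l₂ k
        rw [← List.append_assoc, List.getElem?_append_right (by simp)]
        congr 1
        simp
      set l := t :: recBody v.length g :: i :: φ i :: n :: (v ++ as) with hl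
      refine tcomp_cmp (b := φ (i + 1)) (tcomp_pushArgs (xs := i :: φ i :: v)
        (.cons ?_ (.cons ?_ (forall₂_range' [n] v l))) ?_) ?_
      · have := hpos [n] l 2
        rw [show [n].length + v.length + 2 = v.length + 3 by simp; omega] at this
        exact this
      · have := hpos [n] l 3
        rw [show [n].length + v.length + 3 = v.length + 4 by simp; omega] at this
        exact this
      · exact hg i _
      · refine tcomp_cmp (b := i + 1) (tcomp_cmp (b := i) (tcomp_arg ?_) tcomp_sidx) ?_
        · have := hpos [φ (i + 1), n] l 2
          rw [show [φ (i + 1), n].length + v.length + 2 = v.length + 4 by simp; omega] at this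
          exact this
        refine tcomp_cmp (b := recBody v.length g) (tcomp_arg ?_) ?_
        · have := hpos [i + 1, φ (i + 1), n] l 1
          rw [show [i + 1, φ (i + 1), n].length + v.length + 1 = v.length + 4 by
            simp; omega] at this
          exact this
        exact tcomp_cmp (tcomp_arg rfl) (tcomp_uidx (ih (i + 1) (by omega) l))

lemma exists_index_of_primrec' {n : ℕ} {f : List.Vector ℕ n → ℕ} (hf : Nat.Primrec' f) :
    ∃ e, ∀ (Fs : List Tp2) (fs : List (ℕ → ℕ)) (v : List.Vector ℕ n) (as : List ℕ),
      TComp e Fs fs (v.toList ++ as) (f v) := by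
  induction hf with
  | zero => exact ⟨kst 0, fun Fs fs v as => tcomp_kst 0⟩
  | succ =>
    refine ⟨sidx, fun Fs fs v as => ?_⟩
    rw [← List.Vector.cons_head_tail v, List.Vector.toList_cons]
    exact tcomp_sidx
  | get i =>
    refine ⟨arg i, fun Fs fs v as => tcomp_arg ?_⟩
    rw [List.getElem?_append_left (by simp)]
    simp [List.Vector.get_eq_get_toList]
  | @comp m n f g _ _ ihf ihg =>
    obtain ⟨e, he⟩ := ihf
    choose d hd using ihg
    refine ⟨pushEvals m e (List.ofFn d), fun Fs fs v as => ?_⟩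
    have key : TComp (pushEvals v.toList.length e (List.ofFn d)) Fs fs (v.toList ++ as)
        (f (List.Vector.ofFn fun i => g i v)) := by
      refine tcomp_pushEvals (xs := List.ofFn fun i => g i v) ?_ ?_
      · refine List.forall₂_iff_get.2 ⟨by simp, fun i h1 h2 as => ?_⟩
        simpa using hd ⟨i, by simpa using h1⟩ Fs fs v as
      · have := he Fs fs (List.Vector.ofFn fun i => g i v) (v.toList ++ as)
        rwa [List.Vector.toList_ofFn] at this
    rwa [List.Vector.toList_length] at key
  | @prec n f g _ _ ihf ihg =>
    obtain ⟨e, he⟩ := ihf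
    obtain ⟨d, hd⟩ := ihg
    refine ⟨cmp (cmp (cmp (recBody n d) (kst (recBody n d))) (kst 0))
      (pushArgs e (List.range' 1 n)), fun Fs fs v as => ?_⟩
    obtain ⟨k, w, rfl⟩ : ∃ k w, v = k ::ᵥ w := ⟨_, _, (List.Vector.cons_head_tail v).symm⟩
    simp only [List.Vector.toList_cons, List.Vector.head_cons, List.Vector.tail_cons,
      List.cons_append]
    have hw : n = w.toList.length := by simp
    refine tcomp_cmp (b := f w) (tcomp_pushArgs (xs := w.toList) ?_ (he _ _ _ _)) ?_
    · have := forall₂_range' [k] w.toList as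
      rwa [← hw] at this
    refine tcomp_cmp (tcomp_kst 0) (tcomp_cmp (tcomp_kst _) ?_)
    have := tcomp_recBody (Fs := Fs) (fs := fs) (v := w.toList) (g := d)
      (φ := fun k => Nat.rec (f w) (fun y IH => g (y ::ᵥ IH ::ᵥ w)) k) (fun i as => by
        have := hd Fs fs (i ::ᵥ (Nat.rec (f w) (fun y IH => g (y ::ᵥ IH ::ᵥ w)) i) ::ᵥ w) as
        simpa only [List.Vector.toList_cons, List.cons_append] using this) k k 0 (by omega) as
    rw [← hw] at this
    exact this

/-- An index of the function `h`, if `h` is primitive recursive. -/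
noncomputable def num (h : ℕ → ℕ) : ℕ :=
  Classical.epsilon fun e => ∀ (Fs : List Tp2) (fs : List (ℕ → ℕ)) (a : ℕ) (as : List ℕ),
    TComp e Fs fs (a :: as) (h a)

lemma tcomp_num {h : ℕ → ℕ} (hh : Primrec h) {Fs : List Tp2} {fs : List (ℕ → ℕ)} {a : ℕ}
    {as : List ℕ} : TComp (num h) Fs fs (a :: as) (h a) := by
  obtain ⟨e, he⟩ := exists_index_of_primrec' (Nat.Primrec'.prim_iff₁.2 hh)
  exact Classical.epsilon_spec (p := fun e => ∀ (Fs : List Tp2) (fs : List (ℕ → ℕ)) (a : ℕ)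
    (as : List ℕ), TComp e Fs fs (a :: as) (h a)) ⟨e, fun Fs fs a as => he Fs fs (a ::ᵥ .nil) as⟩
    Fs fs a as

/-- An index of the binary function `h`, if `h` is primitive recursive. -/
noncomputable def bin (h : ℕ → ℕ → ℕ) : ℕ :=
  Classical.epsilon fun e => ∀ (Fs : List Tp2) (fs : List (ℕ → ℕ)) (a b : ℕ) (as : List ℕ),
    TComp e Fs fs (a :: b :: as) (h a b)

lemma tcomp_bin {h : ℕ → ℕ → ℕ} (hh : Primrec₂ h) {Fs : List Tp2} {fs : List (ℕ → ℕ)} {a b : ℕ}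
    {as : List ℕ} : TComp (bin h) Fs fs (a :: b :: as) (h a b) := by
  obtain ⟨e, he⟩ := exists_index_of_primrec' (Nat.Primrec'.prim_iff₂.2 hh)
  exact Classical.epsilon_spec (p := fun e => ∀ (Fs : List Tp2) (fs : List (ℕ → ℕ)) (a b : ℕ)
    (as : List ℕ), TComp e Fs fs (a :: b :: as) (h a b))
    ⟨e, fun Fs fs a b as => he Fs fs (a ::ᵥ b ::ᵥ .nil) as⟩ Fs fs a b as

/-! ### Branching with variable indices, and quantifiers -/

/-- The index that branches on the value of `e`, to `e₀` if it is zero and to `e₁` otherwise. The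
value is put in front of the number arguments. In contrast to `branch`, this is a primitive
recursive function of `e`, `e₀` and `e₁`. -/
noncomputable def ite (e e₀ e₁ : ℕ) : ℕ :=
  cmp (cmp uidx (cmp (bin fun c a => if a = 0 then c.unpair.1 else c.unpair.2)
    (kst (Nat.pair e₀ e₁)))) e

/-- The negation of the truth value of `e`. -/
noncomputable def neg (e : ℕ) : ℕ := ite e (kst 1) (kst 0)

/-- The index of `∃ z, P z`, if `e` decides `P z`, where `z` is the first number argument and the
first function argument is irrelevant. It is an induction over the operator
`f ↦ {n | P n ∨ n + 1 ∈ f}`. -/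
noncomputable def ex (e : ℕ) : ℕ :=
  cmp (iidx (cmp (ite e (cmp (app 0) (addIdx 2 (arg 1))) (kst 1)) (cmp (app 0) (kst 0)))) (kst 0)

/-- The index of `∀ z, P z`, if `e` decides `P z`, with the same conventions as in `ex`. -/
noncomputable def all (e : ℕ) : ℕ := neg (ex (neg e))

/-- The set with characteristic function `k ↦ g (k + 1)`. -/
def tailSet (g : ℕ → ℕ) : Cantor := fun k => decide (g (k + 1) ≠ 0)

lemma tailSet_concat (n : ℕ) (f : Cantor) : tailSet (concat n f) = f := by
  funext k
  cases h : f k <;> simp [tailSet, concat, h]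

/-- The index of the membership of the number at position `px` in the section with index the number
at position `py`, for the set coded by the function at position `q`. -/
noncomputable def memAt (q px py : ℕ) : ℕ :=
  cmp (cmp (cmp (app q) (bin fun x y => Nat.pair x y + 1)) (arg (px + 1))) (arg py)

/-- The index of the accessibility of `0` for the set coded by the first function argument. -/
noncomputable def accIdx : ℕ :=
  cmp (iidx (cmp (all (ite (memAt 2 0 1) (kst 1) (cmp (app 1) (addIdx 2 (arg 1)))))
    (cmp (app 0) (kst 0)))) (kst 0)

section

variable {Fs : List Tp2} {fs : List (ℕ → ℕ)} {as : List ℕ} {e e₀ e₁ : ℕ} {P Q : Prop}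

lemma primrec₂_select :
    Primrec₂ fun c a : ℕ => if a = 0 then c.unpair.1 else c.unpair.2 :=
  Primrec.ite (Primrec.eq.comp .snd (.const 0)) (Primrec.fst.comp (Primrec.unpair.comp .fst))
    (Primrec.snd.comp (Primrec.unpair.comp .fst))

lemma tcomp_ite {v c : ℕ} (h : TComp e Fs fs as v) (h₀ : v = 0 → TComp e₀ Fs fs (v :: as) c)
    (h₁ : v ≠ 0 → TComp e₁ Fs fs (v :: as) c) : TComp (ite e e₀ e₁) Fs fs as c := by
  refine tcomp_cmp h (tcomp_cmp (tcomp_cmp (tcomp_kst _) (tcomp_bin primrec₂_select))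
    (tcomp_uidx ?_))
  by_cases hv : v = 0
  · simpa [hv] using h₀ hv
  · simpa [hv] using h₁ hv

lemma tb_ite (h : TB e Fs fs as P) (h₀ : ∀ v, ¬P → TB e₀ Fs fs (v :: as) Q)
    (h₁ : ∀ v, P → TB e₁ Fs fs (v :: as) Q) : TB (ite e e₀ e₁) Fs fs as Q := by
  obtain ⟨v, hv, hvP⟩ := h
  by_cases hP : P
  · obtain ⟨w, hw, hwQ⟩ := h₁ v hP
    exact ⟨w, tcomp_ite hv (fun h => absurd h (hvP.2 hP)) (fun _ => hw), hwQ⟩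
  · obtain ⟨w, hw, hwQ⟩ := h₀ v hP
    exact ⟨w, tcomp_ite hv (fun _ => hw) (fun h => absurd (hvP.1 h) hP), hwQ⟩

lemma tb_kst_zero_of_not (h : ¬P) : TB (kst 0) Fs fs as P := tb_kst_zero.congr (by simp [h])

lemma tb_kst_one_of (h : P) : TB (kst 1) Fs fs as P := tb_kst_one.congr (by simp [h])

lemma tb_cmp {v : ℕ} (h : TComp e₀ Fs fs as v) (h₁ : TB e Fs fs (v :: as) P) :
    TB (cmp e e₀) Fs fs as P := by
  obtain ⟨w, hw, hP⟩ := h₁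
  exact ⟨w, tcomp_cmp h hw, hP⟩

lemma tb_neg (h : TB e Fs fs as P) : TB (neg e) Fs fs as (¬P) :=
  tb_ite h (fun _ h => tb_kst_one_of h) (fun _ h => tb_kst_zero_of_not (not_not.2 h))

lemma tb_app {q a : ℕ} {f : ℕ → ℕ} (h : fs[q]? = some f) :
    TB (app q) Fs fs (a :: as) (f a ≠ 0) := ⟨f a, tcomp_app h, Iff.rfl⟩

lemma tb_ex {P : ℕ → Prop} (h : ∀ g z, TB e Fs (g :: fs) (z :: as) (P z)) :
    TB (ex e) Fs fs as (∃ z, P z) := by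
  classical
  refine tb_cmp (tcomp_kst 0) ((tb_iidx (Q := fun g => P (g 0) ∨ g (g 0 + 2) ≠ 0)
    (Γ := fun f n => decide (P n ∨ f (n + 1) = true)) (fun g => ?_) (fun f n => ?_) 0).congr ?_)
  · refine tb_cmp (tcomp_cmp (tcomp_kst 0) (tcomp_app rfl)) ?_
    refine tb_ite (P := P (g 0)) (h g (g 0)) (fun v hP => ?_) fun v hP => tb_kst_one_of (Or.inl hP)
    exact tb_cmp (tcomp_addIdx 2 (tcomp_arg rfl)) ((tb_app rfl).congr (by simp [hP]))
  · simp [concat]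
  · set Γ : Cantor → Cantor := fun f n => decide (P n ∨ f (n + 1) = true) with hΓ
    have happ : ∀ f n, Γ f n = true ↔ P n ∨ f (n + 1) = true := by simp [hΓ]
    have hcl := cantor_le_iff.1 (apply_ind_le Γ)
    constructor
    · suffices h : ∀ n, ind Γ n = true → ∃ z, P z from h 0
      refine ind_invariant (fun f => ∀ n, f n = true → ∃ z, P z) (by simp) ?_ ?_
      · intro f hf n hn
        rw [cantor_sup_apply, happ] at hn
        rcases hn with hn | hn | hn
        · exact hf n hn
        · exact ⟨n, hn⟩
        · exact hf _ hn
      · intro β s hs n hn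
        rw [cantor_iSup_apply] at hn
        obtain ⟨i, hi⟩ := hn
        exact hs i n hi
    · rintro ⟨z, hz⟩
      have : ∀ k, k ≤ z → ind Γ (z - k) = true := by
        intro k
        induction k with
        | zero => exact fun _ => hcl _ ((happ _ _).2 (Or.inl hz))
        | succ k ih =>
          intro hk
          refine hcl _ ((happ _ _).2 (Or.inr ?_))
          rw [show z - (k + 1) + 1 = z - k by omega]
          exact ih (by omega)
      simpa using this z le_rfl

lemma tb_all {P : ℕ → Prop} (h : ∀ g z, TB e Fs (g :: fs) (z :: as) (P z)) :
    TB (all e) Fs fs as (∀ z, P z) :=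
  (tb_neg (tb_ex fun g z => tb_neg (h g z))).congr (by simp)

lemma primrec₂_pair_succ : Primrec₂ fun x y => Nat.pair x y + 1 :=
  Primrec.succ.comp Primrec₂.natPair

lemma tb_memAt {q px py x y : ℕ} {g : ℕ → ℕ} (hq : fs[q]? = some g) (hx : as[px]? = some x)
    (hy : as[py]? = some y) : TB (memAt q px py) Fs fs as (sec (tailSet g) y x = true) := by
  refine tb_cmp (tcomp_arg hy) (tb_cmp (tcomp_arg (a := x) (by simpa using hx))
    (tb_cmp (tcomp_bin primrec₂_pair_succ) ((tb_app hq).congr ?_)))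
  simp [sec, tailSet]

lemma tb_accIdx {g : ℕ → ℕ} : TB accIdx Fs (g :: fs) as (SecAcc (tailSet g) 0) := by
  classical
  refine tb_cmp (tcomp_kst 0) ((tb_iidx
    (Q := fun h => ∀ z, sec (tailSet g) (h 0) z = true → h (z + 2) ≠ 0)
    (Γ := fun f y => decide (∀ z, sec (tailSet g) y z = true → f (z + 1) = true))
    (fun h => ?_) (fun f n => ?_) 0).congr ?_)
  · refine tb_cmp (tcomp_cmp (tcomp_kst 0) (tcomp_app rfl)) (tb_all fun g' z => ?_)
    refine tb_ite (tb_memAt (g := g) (x := z) (y := h 0) rfl rfl rfl)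
      (fun v hP => tb_kst_one_of fun h => absurd h hP) fun v hP => ?_
    exact tb_cmp (tcomp_addIdx 2 (tcomp_arg (a := z) rfl)) ((tb_app rfl).congr (by simp [hP]))
  · simp [concat]
  · set Γ : Cantor → Cantor :=
      fun f y => decide (∀ z, sec (tailSet g) y z = true → f (z + 1) = true) with hΓ
    have happ : ∀ f y, Γ f y = true ↔ ∀ z, sec (tailSet g) y z = true → f (z + 1) = true := by
      simp [hΓ]
    have hcl := cantor_le_iff.1 (apply_ind_le Γ)
    constructor
    · suffices h : ∀ n, ind Γ n = true → SecAcc (tailSet g) n from h 0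
      refine ind_invariant (fun f => ∀ n, f n = true → SecAcc (tailSet g) n) (by simp) ?_ ?_
      · intro f hf n hn
        rw [cantor_sup_apply, happ] at hn
        rcases hn with hn | hn
        · exact hf n hn
        · refine ⟨_, ?_⟩
          rintro _ ⟨z, rfl, hz⟩
          exact hf _ (hn z hz)
      · intro β s hs n hn
        rw [cantor_iSup_apply] at hn
        obtain ⟨i, hi⟩ := hn
        exact hs i n hi
    · generalize 0 = y
      intro h
      induction h with
      | intro y _ ih => exact hcl _ ((happ _ _).2 fun z hz => ih _ ⟨z, rfl, hz⟩)

end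

/-! ### Indices as primitive recursive functions of their parts -/

section

variable {α : Type} [Primcodable α] {f g h : α → ℕ}

lemma primrec_seqNum {l : α → List ℕ} (hl : Primrec l) : Primrec fun a => seqNum (l a) :=
  Primrec.encode.comp hl

lemma primrec_kst (hf : Primrec f) : Primrec fun a => kst (f a) :=
  primrec_seqNum (Primrec.list_cons.comp (.const 2) (Primrec.list_cons.comp hf (.const [])))

lemma primrec_cmp (hf : Primrec f) (hg : Primrec g) : Primrec fun a => cmp (f a) (g a) :=
  primrec_seqNum (Primrec.list_cons.comp (.const 4) (Primrec.list_cons.comp hf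
    (Primrec.list_cons.comp hg (.const []))))

lemma primrec_iidx (hf : Primrec f) : Primrec fun a => iidx (f a) :=
  primrec_seqNum (Primrec.list_cons.comp (.const 8) (Primrec.list_cons.comp (.const 3)
    (Primrec.list_cons.comp hf (.const []))))

lemma primrec_swapList : Primrec swapList := by
  refine Primrec.list_map (Primrec.list_range.comp Primrec.succ) ?_
  exact Primrec.ite (Primrec.eq.comp .snd (.const 0)) .fst
    (Primrec.ite (Primrec.eq.comp .snd .fst) (.const 0) .snd)

/-- The scheme of permuting the arguments, as a function of the parts of the index. -/
def permIdx (e : ℕ) (t₁ t₂ t₃ : List ℕ) : ℕ := seqNum [6, e, seqNum t₁, seqNum t₂, seqNum t₃]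

lemma primrec_permIdx {t₁ t₂ t₃ : α → List ℕ} (hf : Primrec f) (h₁ : Primrec t₁) (h₂ : Primrec t₂)
    (h₃ : Primrec t₃) : Primrec fun a => permIdx (f a) (t₁ a) (t₂ a) (t₃ a) :=
  primrec_seqNum (Primrec.list_cons.comp (.const 6) (Primrec.list_cons.comp hf
    (Primrec.list_cons.comp (primrec_seqNum h₁) (Primrec.list_cons.comp (primrec_seqNum h₂)
      (Primrec.list_cons.comp (primrec_seqNum h₃) (.const []))))))

lemma primrec_arg (hf : Primrec f) : Primrec fun a => arg (f a) :=
  primrec_permIdx (.const _) (.const []) (.const []) (primrec_swapList.comp hf)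

lemma primrec_app (hf : Primrec f) : Primrec fun a => app (f a) :=
  primrec_permIdx (.const _) (.const []) (primrec_swapList.comp hf) (.const [])

lemma primrec_ite (hf : Primrec f) (hg : Primrec g) (hh : Primrec h) :
    Primrec fun a => ite (f a) (g a) (h a) :=
  primrec_cmp (primrec_cmp (.const _) (primrec_cmp (.const _)
    (primrec_kst (Primrec₂.natPair.comp hg hh)))) hf

lemma primrec_neg (hf : Primrec f) : Primrec fun a => neg (f a) :=
  primrec_ite hf (.const _) (.const _)

lemma primrec_all (hf : Primrec f) : Primrec fun a => all (f a) := by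
  have hex : ∀ {f : α → ℕ}, Primrec f → Primrec fun a => ex (f a) := fun hf =>
    primrec_cmp (primrec_iidx (primrec_cmp (primrec_ite hf (.const _) (.const _)) (.const _)))
      (.const _)
  exact primrec_neg (hex (primrec_neg hf))

lemma primrec_memAt {px py : ℕ} (hf : Primrec f) : Primrec fun a => memAt (f a) px py :=
  primrec_cmp (primrec_cmp (primrec_cmp (primrec_app hf) (.const _)) (.const _)) (.const _)

end

/-! ### Environments -/

/-- A finite description of an infinite sequence of references to arguments. It lists references,
and continues with all positions from a given one on. A reference consists of a position and two
parameters, which are used for functions only. -/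
abbrev Env : Type := List (ℕ × ℕ × ℕ) × ℕ

/-- The reference at position `i` of the environment `E`. -/
def lookup (E : Env) (i : ℕ) : ℕ × ℕ × ℕ := E.1[i]?.getD (E.2 + (i - E.1.length), 0, 0)

/-- The environment `E`, after `k` further arguments have been put in front. -/
def shift (k : ℕ) (E : Env) : Env := (E.1.map fun r => (r.1 + k, r.2), E.2 + k)

/-- The environment `E` with the reference `r` put in front. -/
def push (r : ℕ × ℕ × ℕ) (E : Env) : Env := (r :: E.1, E.2)

/-- The environment `E` without its first reference. -/
def pop (E : Env) : Env := (E.1.tail, E.2 + (1 - E.1.length))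

/-- The environment `E`, permuted by the permutation coded by `t`. -/
def perm (t : List ℕ) (E : Env) : Env :=
  ((List.range (max t.length E.1.length)).map fun i => lookup E (t.getD i i),
    E.2 + (t.length - E.1.length))

lemma lookup_shift (k : ℕ) (E : Env) (i : ℕ) :
    lookup (shift k E) i = ((lookup E i).1 + k, (lookup E i).2) := by
  rcases lt_or_ge i E.1.length with h | h
  · simp [lookup, shift, h]
  · simp [lookup, shift, h]
    omega

lemma lookup_push_zero (r : ℕ × ℕ × ℕ) (E : Env) : lookup (push r E) 0 = r := rfl

lemma lookup_push_succ (r : ℕ × ℕ × ℕ) (E : Env) (i : ℕ) :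
    lookup (push r E) (i + 1) = lookup E i := by
  simp [lookup, push]

lemma lookup_pop (E : Env) (i : ℕ) : lookup (pop E) i = lookup E (i + 1) := by
  obtain ⟨_ | ⟨r, l⟩, k⟩ := E
  · simp [lookup, pop]
    omega
  · simp [lookup, pop]

lemma lookup_perm (t : List ℕ) (E : Env) (i : ℕ) :
    lookup (perm t E) i = lookup E (t.getD i i) := by
  rcases lt_or_ge i (max t.length E.1.length) with h | h
  · simp [lookup, perm, List.getElem?_map, List.getElem?_range h]
  · have h1 := (le_max_left _ _).trans h
    have h2 := (le_max_right _ _).trans h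
    have h3 : t.getD i i = i := List.getD_eq_default _ _ h1
    rw [h3]
    simp only [lookup, perm]
    rw [List.getElem?_eq_none (by simpa using h), List.getElem?_eq_none h2]
    simp
    omega

section

variable {α : Type} [Primcodable α] {E : α → Env}

lemma primrec_lookup {i : α → ℕ} (hE : Primrec E) (hi : Primrec i) :
    Primrec fun a => lookup (E a) (i a) := by
  refine Primrec.option_getD.comp (Primrec.list_getElem?.comp (Primrec.fst.comp hE) hi) ?_
  exact Primrec.pair (Primrec.nat_add.comp (Primrec.snd.comp hE) (Primrec.nat_sub.comp hi
    (Primrec.list_length.comp (Primrec.fst.comp hE)))) (.const _)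

lemma primrec_shift (k : ℕ) (hE : Primrec E) : Primrec fun a => shift k (E a) := by
  refine Primrec.pair (Primrec.list_map (Primrec.fst.comp hE) ?_)
    (Primrec.nat_add.comp (Primrec.snd.comp hE) (.const k))
  exact Primrec.pair (Primrec.nat_add.comp (Primrec.fst.comp .snd) (.const k))
    (Primrec.snd.comp .snd)

lemma primrec_push {r : α → ℕ × ℕ × ℕ} (hr : Primrec r) (hE : Primrec E) :
    Primrec fun a => push (r a) (E a) :=
  Primrec.pair (Primrec.list_cons.comp hr (Primrec.fst.comp hE)) (Primrec.snd.comp hE)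

lemma primrec_pop (hE : Primrec E) : Primrec fun a => pop (E a) :=
  Primrec.pair (Primrec.list_tail.comp (Primrec.fst.comp hE))
    (Primrec.nat_add.comp (Primrec.snd.comp hE) (Primrec.nat_sub.comp (.const 1)
      (Primrec.list_length.comp (Primrec.fst.comp hE))))

lemma primrec_perm {t : α → List ℕ} (ht : Primrec t) (hE : Primrec E) :
    Primrec fun a => perm (t a) (E a) := by
  have h1 := Primrec.list_length.comp ht
  have h2 := Primrec.list_length.comp (Primrec.fst.comp hE)
  refine Primrec.pair (Primrec.list_map (Primrec.list_range.comp (Primrec.nat_max.comp h1 h2)) ?_)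
    (Primrec.nat_add.comp (Primrec.snd.comp hE) (Primrec.nat_sub.comp h1 h2))
  refine primrec_lookup (hE.comp .fst) ?_
  refine (Primrec.option_getD.comp (Primrec.list_getElem?.comp (ht.comp .fst) .snd) .snd).of_eq ?_
  intro a
  rw [List.getD_eq_getElem?_getD]

end

/-- The references of `E` refer to the entries of `vs`, if `D r x` says that `r` refers to `x`.
There may be further references, which refer to nothing. -/
def Refers {β : Type} (D : ℕ × ℕ × ℕ → β → Prop) (E : Env) (vs : List β) : Prop :=
  ∀ i x, vs[i]? = some x → D (lookup E i) x

/-- References to the entries of a list. -/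
def RefAt {β : Type} (l : List β) (r : ℕ × ℕ × ℕ) (x : β) : Prop := l[r.1]? = some x

/-- References to functions: the reference `(q, 0, n)` is to the function at position `q`, and
the reference `(q, y + 1, n)` is to `n ⌢ X_y`, where `X_y` is the section with index `y` of the set
coded by the function at position `q`. -/
def RefFun (fs : List (ℕ → ℕ)) (r : ℕ × ℕ × ℕ) (f : ℕ → ℕ) : Prop :=
  ∃ g, fs[r.1]? = some g ∧
    f = if r.2.1 = 0 then g else concat r.2.2 (sec (tailSet g) (r.2.1 - 1))

section

variable {β : Type} {D : ℕ × ℕ × ℕ → β → Prop} {E : Env} {vs : List β}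

lemma Refers.push {r : ℕ × ℕ × ℕ} {x : β} (h : Refers D E vs) (hr : D r x) :
    Refers D (push r E) (x :: vs) := by
  intro i y hy
  cases i with
  | zero =>
    simp only [List.getElem?_cons_zero, Option.some.injEq] at hy
    rw [lookup_push_zero, ← hy]
    exact hr
  | succ i =>
    rw [lookup_push_succ]
    exact h i y (by simpa using hy)

lemma Refers.pop {x : β} (h : Refers D E (x :: vs)) : Refers D (pop E) vs := by
  intro i y hy
  rw [lookup_pop]
  exact h (i + 1) y (by simpa using hy)

lemma Refers.head {x : β} (h : Refers D E (x :: vs)) : D (lookup E 0) x := h 0 x rfl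

lemma Refers.perm {t : List ℕ} (h : Refers D E vs) (ht : PermCode t vs) :
    Refers D (perm t E) (permuted t vs) := by
  intro i y hy
  rw [lookup_perm]
  rw [getElem?_permuted ht] at hy
  exact h _ y hy

lemma Refers.shift {D' : ℕ × ℕ × ℕ → β → Prop} {k : ℕ} (h : Refers D E vs)
    (hD : ∀ r x, D r x → D' (r.1 + k, r.2) x) : Refers D' (shift k E) vs := by
  intro i y hy
  rw [lookup_shift]
  exact hD _ _ (h i y hy)

lemma Refers.append {l : List β} (h : Refers (RefAt l) E vs) (l' : List β) :
    Refers (RefAt (l' ++ l)) (NonMonotoneInduction.shift l'.length E) vs :=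
  h.shift fun r x hr => by
    rw [RefAt, List.getElem?_append_right (by simp)]
    simpa [RefAt] using hr

lemma Refers.append_fun {fs vf : List (ℕ → ℕ)} (h : Refers (RefFun fs) E vf)
    (gs : List (ℕ → ℕ)) :
    Refers (RefFun (gs ++ fs)) (NonMonotoneInduction.shift gs.length E) vf :=
  h.shift fun r x ⟨g, hg, hx⟩ => by
    refine ⟨g, ?_, hx⟩
    rw [List.getElem?_append_right (by simp)]
    simpa using hg

end

/-- The index that applies the function with reference `r` to the first number argument. -/
noncomputable def refApp (r : ℕ × ℕ × ℕ) : ℕ :=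
  if r.2.1 = 0 then app r.1 else
    ite (arg 0) (kst r.2.2) (cmp sgIdx (cmp (app r.1)
      (cmp (cmp (bin fun y a => Nat.pair (a - 1) y + 1) (kst (r.2.1 - 1))) (arg 1))))

lemma tcomp_refApp {Fs : List Tp2} {fs : List (ℕ → ℕ)} {a : ℕ} {as : List ℕ} {r : ℕ × ℕ × ℕ}
    {f : ℕ → ℕ} (h : RefFun fs r f) : TComp (refApp r) Fs fs (a :: as) (f a) := by
  obtain ⟨g, hg, rfl⟩ := h
  rw [refApp]
  split_ifs with h0
  · exact tcomp_app hg
  · refine tcomp_ite (v := a) (tcomp_arg rfl) ?_ ?_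
    · rintro rfl
      exact tcomp_kst _
    · intro ha
      have hprim : Primrec₂ fun y a => Nat.pair (a - 1) y + 1 :=
        Primrec.succ.comp (Primrec₂.natPair.comp (Primrec.pred.comp .snd) .fst)
      have := tcomp_cmp (tcomp_cmp (tcomp_cmp (Fs := Fs) (fs := fs) (as := a :: a :: as)
        (tcomp_arg (p := 1) (a := a) rfl) (tcomp_cmp (tcomp_kst (r.2.1 - 1)) (tcomp_bin hprim)))
        (tcomp_app hg)) tcomp_sgIdx
      convert this using 1
      obtain ⟨b, rfl⟩ := Nat.exists_eq_succ_of_ne_zero ha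
      simp only [concat, sec, tailSet]
      split_ifs with h1 <;> simp_all

lemma primrec_refApp {α : Type} [Primcodable α] {r : α → ℕ × ℕ × ℕ} (hr : Primrec r) :
    Primrec fun a => refApp (r a) := by
  have h1 : Primrec fun a => (r a).1 := Primrec.fst.comp hr
  have h2 : Primrec fun a => (r a).2.1 := Primrec.fst.comp (Primrec.snd.comp hr)
  have h3 : Primrec fun a => (r a).2.2 := Primrec.snd.comp (Primrec.snd.comp hr)
  refine Primrec.ite (Primrec.eq.comp h2 (.const 0)) (primrec_app h1) ?_
  exact primrec_ite (.const _) (primrec_kst h3) (primrec_cmp (.const _) (primrec_cmp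
    (primrec_app h1) (primrec_cmp (primrec_cmp (.const _) (primrec_kst (Primrec.pred.comp h2)))
      (.const _))))

/-! ### The interpreter -/

/-- A task of the interpreter: numbers `k, d, q, y, n` and environments for the three kinds of
arguments. For `k = 0` the task is to evaluate the index `y`. For `k = 1` it is to decide whether
the section with index `y` is correct, where the history is coded by the function at position `q`
and the operator is given by the index `d`. For other `k` it is to evaluate the index `d`, with
`n ⌢ X_y` as an additional first function argument, for the set `X` coded by the function at
position `q`. -/
abbrev Task : Type := (ℕ × ℕ × ℕ × ℕ × ℕ) × Env × Env × Env

/-- The number code of the task `s` for the interpreter with index `u`. -/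
def code (u : ℕ) (s : Task) : ℕ := Nat.pair u (Encodable.encode s)

/-- The code `c` of a task, with the last two numbers of the task replaced by those coded by
`w`. -/
def setParams (c w : ℕ) : ℕ :=
  ((Encodable.decode (α := Task) c.unpair.2).map fun s =>
    code c.unpair.1 ((s.1.1, s.1.2.1, s.1.2.2.1, w.unpair.1, w.unpair.2), s.2)).getD 0

/-- The index that runs the interpreter `u` on the task `s`. -/
def run (u : ℕ) (s : Task) : ℕ := cmp u (kst (code u s))

/-- The index that runs the interpreter `u` on the task `s`, with the last two numbers of the task
replaced by the number arguments at the positions `p` and `p'`. -/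
noncomputable def runAt (u : ℕ) (s : Task) (p p' : ℕ) : ℕ :=
  cmp (cmp u (cmp (bin setParams) (kst (code u s))))
    (cmp (cmp (bin Nat.pair) (arg (p + 1))) (arg p'))

/-- The index that decides the correctness of the section with index `y`. In the comments, the
number arguments are listed, with `_` for truth values. -/
noncomputable def okIdx (u d q y : ℕ) (E₁ E₂ E₃ : Env) : ℕ :=
  cmp (all
    -- z, y
    (ite (memAt (q + 1) 0 1) (kst 1) (cmp
      -- z + 1, _, z, y
      (ite (runAt u ((1, d, q + 1, 0, 0), E₁, shift 1 E₂, shift 5 E₃) 0 0) (kst 0)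
        (ite (runAt u ((2, d, q + 1, 0, 0), E₁, shift 1 E₂, shift 6 E₃) 1 3) (kst 0) (all
          -- x, _, _, z + 1, _, z, y
          (ite (memAt (q + 2) 0 6)
            (ite (memAt (q + 2) 1 4)
              (neg (runAt u ((2, d, q + 2, 0, 0), E₁, shift 2 E₂, shift 10 E₃) 5 2))
              (kst 0))
            (kst 1)))))
      (addIdx 1 (arg 1)))))
    (kst y)

/-- The index of the total operator that builds up the history of the induction over the operator
given by the index `d`. -/
noncomputable def stepIdx (u d : ℕ) (E₁ E₂ E₃ : Env) : ℕ :=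
  ite accIdx (kst 0) (ite (run u ((1, d, 0, 0, 0), E₁, shift 1 E₂, shift 1 E₃)) (kst 0)
    (cmp (cmp (cmp (cmp (cmp
      -- 0, y - 1, y, x, k, _, _, where `k` is the pair of `x` and `y`
      (ite (arg 2)
        (runAt u ((2, d, 0, 0, 0), E₁, shift 1 E₂, shift 9 E₃) 1 4)
        (ite (memAt 0 2 1)
          (ite (memAt 0 5 2) (kst 0)
            (runAt u ((2, d, 0, 0, 0), E₁, shift 1 E₂, shift 11 E₃) 3 4))
          (kst 0)))
      (kst 0)) (cmp (num Nat.pred) (arg 0))) (cmp (num fun k => k.unpair.2) (arg 1)))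
      (cmp (num fun k => k.unpair.1) (arg 0))) (cmp (app 0) (kst 0))))

/-- The index for the evaluation of the index `e`, for given environments. The schemes are
recognized by the first entries of the list coded by `e`. -/
noncomputable def evalIdx (u e : ℕ) (E₁ E₂ E₃ : Env) : ℕ :=
  let l : List ℕ := (Encodable.decode e).getD []
  let p := (lookup E₃ 0).1
  if l.getD 0 0 = 1 then cmp sidx (arg p)
  else if l.getD 0 0 = 2 then kst (l.getD 1 0)
  else if l.getD 0 0 = 3 then arg p
  else if l.getD 0 0 = 4 then
    cmp (run u ((0, 0, 0, l.getD 1 0, 0), E₁, E₂, push (0, 0, 0) (shift 1 E₃)))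
      (run u ((0, 0, 0, l.getD 2 0, 0), E₁, E₂, E₃))
  else if l.getD 0 0 = 6 then
    run u ((0, 0, 0, l.getD 1 0, 0), perm ((Encodable.decode (l.getD 2 0)).getD []) E₁,
      perm ((Encodable.decode (l.getD 3 0)).getD []) E₂,
      perm ((Encodable.decode (l.getD 4 0)).getD []) E₃)
  else if l.getD 0 0 = 7 then cmp (refApp (lookup E₂ 0)) (arg p)
  else if l.getD 0 0 = 8 then
    if l.getD 1 0 = 2 then
      permIdx (seqNum [8, 2, permIdx
        (run u ((0, 0, 0, l.getD 2 0, 0), E₁, E₂, push (0, 0, 0) (shift 1 E₃)))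
        (swapList (lookup E₁ 0).1) [] []]) (swapList (lookup E₁ 0).1) [] []
    else cmp (iidx (stepIdx u (l.getD 2 0) E₁ E₂ (pop E₃)))
      (cmp (num fun b => Nat.pair b 0) (arg p))
  else runAt u ((0, 0, 0, 0, 0), E₁, E₂, shift 1 (pop E₃)) p p

/-- The index that performs the task `s`. -/
noncomputable def taskIdx (u : ℕ) (s : Task) : ℕ :=
  if s.1.1 = 0 then evalIdx u s.1.2.2.2.1 s.2.1 s.2.2.1 (shift 1 s.2.2.2)
  else if s.1.1 = 1 then
    okIdx u s.1.2.1 s.1.2.2.1 s.1.2.2.2.1 s.2.1 s.2.2.1 (shift 1 s.2.2.2)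
  else run u ((0, 0, 0, s.1.2.1, 0), s.2.1,
    push (s.1.2.2.1, s.1.2.2.2.1 + 1, s.1.2.2.2.2) s.2.2.1, shift 1 s.2.2.2)

/-- The function from codes of tasks to indices that perform them. -/
noncomputable def taskIdxOfCode (c : ℕ) : ℕ :=
  ((Encodable.decode (α := Task) c.unpair.2).map (taskIdx c.unpair.1)).getD 0

/-- The index of the interpreter, which from the code of a task computes an index that performs the
task, and evaluates it. It can call itself, because its index is a part of the code. -/
noncomputable def interp : ℕ := cmp uidx (num taskIdxOfCode)

section Primrec

variable {α : Type} [Primcodable α]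

lemma primrec_code {u : α → ℕ} {s : α → Task} (hu : Primrec u) (hs : Primrec s) :
    Primrec fun a => code (u a) (s a) :=
  Primrec₂.natPair.comp hu (Primrec.encode.comp hs)

lemma primrec₂_setParams : Primrec₂ setParams := by
  have hu : Primrec fun p : (ℕ × ℕ) × Task => p.1.1.unpair.1 :=
    Primrec.fst.comp (Primrec.unpair.comp (Primrec.fst.comp .fst))
  have hw : Primrec fun p : (ℕ × ℕ) × Task => p.1.2.unpair :=
    Primrec.unpair.comp (Primrec.snd.comp .fst)
  have hs : Primrec fun p : (ℕ × ℕ) × Task => p.2.1 := Primrec.fst.comp .snd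
  refine Primrec.option_getD.comp (Primrec.option_map (Primrec.decode.comp (Primrec.snd.comp
    (Primrec.unpair.comp .fst))) ?_) (.const 0)
  refine primrec_code hu (Primrec.pair (Primrec.pair (Primrec.fst.comp hs) (Primrec.pair
    (Primrec.fst.comp (Primrec.snd.comp hs)) (Primrec.pair (Primrec.fst.comp (Primrec.snd.comp
    (Primrec.snd.comp hs))) hw))) (Primrec.snd.comp .snd))

lemma primrec_run {u : α → ℕ} {s : α → Task} (hu : Primrec u) (hs : Primrec s) :
    Primrec fun a => run (u a) (s a) :=
  primrec_cmp hu (primrec_kst (primrec_code hu hs))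

lemma primrec_runAt {u p p' : α → ℕ} {s : α → Task} (hu : Primrec u) (hs : Primrec s)
    (hp : Primrec p) (hp' : Primrec p') :
    Primrec fun a => runAt (u a) (s a) (p a) (p' a) :=
  primrec_cmp (primrec_cmp hu (primrec_cmp (.const _) (primrec_kst (primrec_code hu hs))))
    (primrec_cmp (primrec_cmp (.const _) (primrec_arg (Primrec.succ.comp hp))) (primrec_arg hp'))

lemma primrec_task {k d q y n : α → ℕ} {E₁ E₂ E₃ : α → Env} (hk : Primrec k) (hd : Primrec d)
    (hq : Primrec q) (hy : Primrec y) (hn : Primrec n) (h₁ : Primrec E₁) (h₂ : Primrec E₂)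
    (h₃ : Primrec E₃) :
    Primrec fun a => (((k a, d a, q a, y a, n a), E₁ a, E₂ a, E₃ a) : Task) :=
  Primrec.pair (hk.pair (hd.pair (hq.pair (hy.pair hn)))) (h₁.pair (h₂.pair h₃))

variable {u d q y e : α → ℕ} {E₁ E₂ E₃ : α → Env}

lemma primrec_okIdx (hu : Primrec u) (hd : Primrec d) (hq : Primrec q) (hy : Primrec y)
    (h₁ : Primrec E₁) (h₂ : Primrec E₂) (h₃ : Primrec E₃) :
    Primrec fun a => okIdx (u a) (d a) (q a) (y a) (E₁ a) (E₂ a) (E₃ a) := by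
  have hq1 : Primrec fun a => q a + 1 := Primrec.succ.comp hq
  have hq2 : Primrec fun a => q a + 2 := Primrec.succ.comp hq1
  have hrun : ∀ {q : α → ℕ} (k i j p p' : ℕ), Primrec q → Primrec fun a =>
      runAt (u a) ((k, d a, q a, 0, 0), E₁ a, shift i (E₂ a), shift j (E₃ a)) p p' :=
    fun k i j p p' hq => primrec_runAt hu (primrec_task (.const k) hd hq (.const 0) (.const 0) h₁
      (primrec_shift i h₂) (primrec_shift j h₃)) (.const p) (.const p')
  exact primrec_cmp (primrec_all (primrec_ite (primrec_memAt hq1) (.const _) (primrec_cmp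
    (primrec_ite (hrun _ _ _ _ _ hq1) (.const _) (primrec_ite (hrun _ _ _ _ _ hq1) (.const _)
      (primrec_all (primrec_ite (primrec_memAt hq2) (primrec_ite (primrec_memAt hq2)
        (primrec_neg (hrun _ _ _ _ _ hq2)) (.const _)) (.const _))))) (.const _)))) (primrec_kst hy)

lemma primrec_stepIdx (hu : Primrec u) (hd : Primrec d) (h₁ : Primrec E₁) (h₂ : Primrec E₂)
    (h₃ : Primrec E₃) : Primrec fun a => stepIdx (u a) (d a) (E₁ a) (E₂ a) (E₃ a) := by
  have hs : ∀ k j : ℕ, Primrec fun a =>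
      (((k, d a, 0, 0, 0), E₁ a, shift 1 (E₂ a), shift j (E₃ a)) : Task) :=
    fun k j => primrec_task (.const k) hd (.const 0) (.const 0) (.const 0) h₁
      (primrec_shift 1 h₂) (primrec_shift j h₃)
  have hrun : ∀ k j p p' : ℕ, Primrec fun a =>
      runAt (u a) ((k, d a, 0, 0, 0), E₁ a, shift 1 (E₂ a), shift j (E₃ a)) p p' :=
    fun k j p p' => primrec_runAt hu (hs k j) (.const p) (.const p')
  exact primrec_ite (.const _) (.const _) (primrec_ite (primrec_run hu (hs _ _)) (.const _)
    (primrec_cmp (primrec_cmp (primrec_cmp (primrec_cmp (primrec_cmp (primrec_ite (.const _)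
      (hrun _ _ _ _) (primrec_ite (.const _) (primrec_ite (.const _) (.const _) (hrun _ _ _ _))
        (.const _))) (.const _)) (.const _)) (.const _)) (.const _)) (.const _)))

lemma primrec_evalIdx (hu : Primrec u) (he : Primrec e) (h₁ : Primrec E₁) (h₂ : Primrec E₂)
    (h₃ : Primrec E₃) : Primrec fun a => evalIdx (u a) (e a) (E₁ a) (E₂ a) (E₃ a) := by
  have hdec : ∀ {e : α → ℕ}, Primrec e →
      Primrec fun a => ((Encodable.decode (e a)).getD [] : List ℕ) := fun he =>
    Primrec.option_getD.comp (Primrec.decode.comp he) (.const [])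
  have hl : ∀ i : ℕ, Primrec fun a =>
      ((Encodable.decode (e a)).getD [] : List ℕ).getD i 0 := fun i =>
    (Primrec.list_getD 0).comp (hdec he) (.const i)
  have hc : ∀ i j : ℕ, PrimrecPred fun a =>
      ((Encodable.decode (e a)).getD [] : List ℕ).getD i 0 = j := fun i j =>
    Primrec.eq.comp (hl i) (.const j)
  have hp : Primrec fun a => (lookup (E₃ a) 0).1 :=
    Primrec.fst.comp (primrec_lookup h₃ (.const 0))
  have hsw : Primrec fun a => swapList (lookup (E₁ a) 0).1 :=
    primrec_swapList.comp (Primrec.fst.comp (primrec_lookup h₁ (.const 0)))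
  have hrun : ∀ (i : ℕ) {E₁ E₂ E₃ : α → Env}, Primrec E₁ → Primrec E₂ → Primrec E₃ →
      Primrec fun a => run (u a) ((0, 0, 0,
        ((Encodable.decode (e a)).getD [] : List ℕ).getD i 0, 0), E₁ a, E₂ a, E₃ a) := fun i _ _ _ h₁ h₂ h₃ =>
    primrec_run hu (primrec_task (.const 0) (.const 0) (.const 0) (hl i) (.const 0) h₁ h₂ h₃)
  have hps : Primrec fun a => push (0, 0, 0) (shift 1 (E₃ a)) :=
    primrec_push (.const _) (primrec_shift 1 h₃)
  refine Primrec.ite (hc 0 1) (primrec_cmp (.const _) (primrec_arg hp)) ?_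
  refine Primrec.ite (hc 0 2) (primrec_kst (hl 1)) ?_
  refine Primrec.ite (hc 0 3) (primrec_arg hp) ?_
  refine Primrec.ite (hc 0 4) (primrec_cmp (hrun 1 h₁ h₂ hps) (hrun 2 h₁ h₂ h₃)) ?_
  refine Primrec.ite (hc 0 6) (hrun 1 (primrec_perm (hdec (hl 2)) h₁)
    (primrec_perm (hdec (hl 3)) h₂) (primrec_perm (hdec (hl 4)) h₃)) ?_
  refine Primrec.ite (hc 0 7) (primrec_cmp (primrec_refApp (primrec_lookup h₂ (.const 0)))
    (primrec_arg hp)) ?_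
  refine Primrec.ite (hc 0 8) (Primrec.ite (hc 1 2) ?_ ?_) ?_
  · exact primrec_permIdx (primrec_seqNum (Primrec.list_cons.comp (.const 8)
      (Primrec.list_cons.comp (.const 2) (Primrec.list_cons.comp (primrec_permIdx
        (hrun 2 h₁ h₂ hps) hsw (.const []) (.const [])) (.const []))))) hsw (.const []) (.const [])
  · exact primrec_cmp (primrec_iidx (primrec_stepIdx hu (hl 2) h₁ h₂ (primrec_pop h₃)))
      (primrec_cmp (.const _) (primrec_arg hp))
  · exact primrec_runAt hu (primrec_task (.const 0) (.const 0) (.const 0) (.const 0) (.const 0)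
      h₁ h₂ (primrec_shift 1 (primrec_pop h₃))) hp hp

lemma primrec₂_taskIdx : Primrec₂ taskIdx := by
  have hu : Primrec fun p : ℕ × Task => p.1 := .fst
  have hk : Primrec fun p : ℕ × Task => p.2.1.1 := Primrec.fst.comp (Primrec.fst.comp .snd)
  have h2 : Primrec fun p : ℕ × Task => p.2.1.2 := Primrec.snd.comp (Primrec.fst.comp .snd)
  have hd : Primrec fun p : ℕ × Task => p.2.1.2.1 := Primrec.fst.comp h2
  have hq : Primrec fun p : ℕ × Task => p.2.1.2.2.1 := Primrec.fst.comp (Primrec.snd.comp h2)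
  have h3 : Primrec fun p : ℕ × Task => p.2.1.2.2.2 := Primrec.snd.comp (Primrec.snd.comp h2)
  have hy : Primrec fun p : ℕ × Task => p.2.1.2.2.2.1 := Primrec.fst.comp h3
  have hn : Primrec fun p : ℕ × Task => p.2.1.2.2.2.2 := Primrec.snd.comp h3
  have hE : Primrec fun p : ℕ × Task => p.2.2 := Primrec.snd.comp .snd
  have hE₁ : Primrec fun p : ℕ × Task => p.2.2.1 := Primrec.fst.comp hE
  have hE₂ : Primrec fun p : ℕ × Task => p.2.2.2.1 := Primrec.fst.comp (Primrec.snd.comp hE)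
  have hE₃ : Primrec fun p : ℕ × Task => shift 1 p.2.2.2.2 :=
    primrec_shift 1 (Primrec.snd.comp (Primrec.snd.comp hE))
  refine Primrec.ite (Primrec.eq.comp hk (.const 0)) (primrec_evalIdx hu hy hE₁ hE₂ hE₃) ?_
  refine Primrec.ite (Primrec.eq.comp hk (.const 1)) (primrec_okIdx hu hd hq hy hE₁ hE₂ hE₃) ?_
  exact primrec_run hu (primrec_task (.const 0) (.const 0) (.const 0) hd (.const 0) hE₁
    (primrec_push (hq.pair ((Primrec.succ.comp hy).pair hn)) hE₂) hE₃)

lemma primrec_taskIdxOfCode : Primrec taskIdxOfCode := by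
  refine Primrec.option_getD.comp (Primrec.option_map (Primrec.decode.comp (Primrec.snd.comp
    Primrec.unpair)) ?_) (.const 0)
  exact primrec₂_taskIdx.comp (Primrec.fst.comp (Primrec.unpair.comp .fst)) .snd

end Primrec

section

variable {Fs : List Tp2} {fs : List (ℕ → ℕ)} {as : List ℕ}

/-- The interpreter performs the task `s` with the value `c`. -/
def Performs (s : Task) (Fs : List Tp2) (fs : List (ℕ → ℕ)) (as : List ℕ) (c : ℕ) : Prop :=
  TComp (taskIdx interp s) Fs fs (code interp s :: as) c

lemma Performs.interp {s : Task} {c : ℕ} (h : Performs s Fs fs as c) :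
    TComp interp Fs fs (code interp s :: as) c := by
  refine tcomp_cmp (tcomp_num primrec_taskIdxOfCode) (tcomp_uidx ?_)
  rw [taskIdxOfCode, code, Nat.unpair_pair, Encodable.encodek]
  exact h

lemma tcomp_run {s : Task} {c : ℕ} (h : Performs s Fs fs as c) :
    TComp (run interp s) Fs fs as c :=
  tcomp_cmp (tcomp_kst _) h.interp

lemma tcomp_runAt {k d q y₀ n₀ y n p p' c : ℕ} {E : Env × Env × Env} (hy : as[p]? = some y)
    (hn : as[p']? = some n)
    (h : Performs ((k, d, q, y, n), E) Fs fs (Nat.pair y n :: as) c) :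
    TComp (runAt interp ((k, d, q, y₀, n₀), E) p p') Fs fs as c := by
  refine tcomp_cmp (b := Nat.pair y n) (tcomp_cmp (tcomp_arg hn) (tcomp_cmp (tcomp_arg (a := y) ?_)
    (tcomp_bin Primrec₂.natPair))) (tcomp_cmp (tcomp_cmp (tcomp_kst _)
      (tcomp_bin primrec₂_setParams)) ?_)
  · simpa using hy
  · convert h.interp using 2
    simp [setParams, code]

end

/-! ### Correctness of the interpreter -/

/-- The interpreter evaluates the index `e` at the arguments `vF`, `vf`, `va` to `c`, whatever
the actual arguments are, as long as the environments of the task refer to `vF`, `vf`, `va`. -/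
def Evaluates (e : ℕ) (vF : List Tp2) (vf : List (ℕ → ℕ)) (va : List ℕ) (c : ℕ) : Prop :=
  ∀ (m : ℕ) (Fs : List Tp2) (fs : List (ℕ → ℕ)) (as : List ℕ) (E₁ E₂ E₃ : Env),
    Refers (RefAt Fs) E₁ vF → Refers (RefFun fs) E₂ vf → Refers (RefAt as) E₃ va →
      Performs ((0, 0, 0, e, m), E₁, E₂, E₃) Fs fs as c

section

variable {d : ℕ} {vF : List Tp2} {vf : List (ℕ → ℕ)} {va : List ℕ} {H : Cantor → Cantor}

/-- The index `d` evaluates the operator `H` at all stages of the induction over `H`. -/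
def EvaluatesStages (d : ℕ) (vF : List Tp2) (vf : List (ℕ → ℕ)) (va : List ℕ)
    (H : Cantor → Cantor) : Prop :=
  ∀ (β : Ordinal.{0}) (n : ℕ), ∃ c, (c ≠ 0 ↔ H (stage H β) n = true) ∧
    Evaluates d vF (concat n (stage H β) :: vf) va c

variable {Fs : List Tp2} {fs : List (ℕ → ℕ)} {as : List ℕ} {E₁ E₂ E₃ : Env} {g : ℕ → ℕ}
  {q y n : ℕ}

/-- The operator `H` can be evaluated at every section that is a stage. -/
lemma EvaluatesStages.exists_performs (hd : EvaluatesStages d vF vf va H)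
    (h₁ : Refers (RefAt Fs) E₁ vF) (h₂ : Refers (RefFun fs) E₂ vf) (h₃ : Refers (RefAt as) E₃ va)
    (hg : fs[q]? = some g) (hy : ∃ β, sec (tailSet g) y = stage H β) (n : ℕ) :
    ∃ c, Performs ((2, d, q, y, n), E₁, E₂, E₃) Fs fs as c ∧
      (c ≠ 0 ↔ H (sec (tailSet g) y) n = true) := by
  obtain ⟨β, hβ⟩ := hy
  obtain ⟨c, hc, hev⟩ := hd β n
  refine ⟨c, ?_, by rw [hβ]; exact hc⟩
  refine tcomp_run (hev _ _ _ _ _ _ _ h₁ (h₂.push ⟨g, hg, ?_⟩) (h₃.append [_]))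
  simp [hβ]

lemma EvaluatesStages.tb_runAt (hd : EvaluatesStages d vF vf va H) {gs : List (ℕ → ℕ)}
    {l : List ℕ} {i j p p' y₀ n₀ : ℕ}
    (h₁ : Refers (RefAt Fs) E₁ vF) (h₂ : Refers (RefFun fs) E₂ vf) (h₃ : Refers (RefAt as) E₃ va)
    (hi : i = gs.length) (hj : j = l.length + 1) (hp : (l ++ as)[p]? = some y)
    (hp' : (l ++ as)[p']? = some n)
    (hg : (gs ++ fs)[q]? = some g) (hy : ∃ β, sec (tailSet g) y = stage H β) :
    TB (runAt interp ((2, d, q, y₀, n₀), E₁, shift i E₂, shift j E₃) p p') Fs (gs ++ fs) (l ++ as)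
      (H (sec (tailSet g) y) n = true) := by
  obtain ⟨c, h, hc⟩ := hd.exists_performs h₁ (h₂.append_fun gs)
    (h₃.append (Nat.pair y n :: l)) hg hy n
  subst hi hj
  exact ⟨c, tcomp_runAt hp hp' h, hc⟩

/-- The interpreter decides the correctness of every accessible section. The operator `H` is
evaluated at `X_{z+1}` only after this section has been found correct, hence to be a stage. -/
lemma EvaluatesStages.exists_performs_ok (hd : EvaluatesStages d vF vf va H)
    (hacc : SecAcc (tailSet g) y) (h₁ : Refers (RefAt Fs) E₁ vF)
    (h₂ : Refers (RefFun fs) E₂ vf) (h₃ : Refers (RefAt as) E₃ va) (hg : fs[q]? = some g) (n : ℕ) :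
    ∃ c, Performs ((1, d, q, y, n), E₁, E₂, E₃) Fs fs as c ∧ (c ≠ 0 ↔ Ok H (tailSet g) y) := by
  induction hacc generalizing fs as E₂ E₃ q n with
  | intro y _ ih =>
    -- the code of the task, which is in front of the number arguments
    generalize hs : (((1, d, q, y, n), E₁, E₂, E₃) : Task) = s
    have h₃' := h₃.append [code interp s]
    suffices h : TB (okIdx interp d q y E₁ E₂ (shift 1 E₃)) Fs fs (code interp s :: as)
        (Ok H (tailSet g) y) by
      obtain ⟨c, hc, hc'⟩ := h
      refine ⟨c, ?_, hc'⟩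
      rw [Performs, ← hs, taskIdx]
      simpa [hs] using hc
    refine TB.congr ?_ ok_iff.symm
    refine tb_cmp (tcomp_kst y) (tb_all fun g₁ z => ?_)
    refine tb_ite (tb_memAt (g := g) (x := z) (y := y) (by simpa using hg) rfl rfl)
      (fun v hv => tb_kst_one_of fun h => absurd h hv) fun v hz => ?_
    refine tb_cmp (tcomp_addIdx 1 (tcomp_arg (a := z) rfl)) ?_
    have hok : TB (runAt interp ((1, d, q + 1, 0, 0), E₁, shift 1 E₂, shift 5 (shift 1 E₃)) 0 0) Fs
        (g₁ :: fs) ((z + 1) :: v :: z :: y :: code interp s :: as) (Ok H (tailSet g) (z + 1)) := by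
      obtain ⟨c, hc, hc'⟩ := ih (z + 1) ⟨z, rfl, hz⟩ (h₂.append_fun [g₁])
        (h₃'.append [Nat.pair (z + 1) (z + 1), z + 1, v, z, y]) (q := q + 1) (by simpa using hg)
        (z + 1)
      exact ⟨c, tcomp_runAt rfl rfl hc, hc'⟩
    refine tb_ite hok (fun v hv => tb_kst_zero_of_not fun h => hv (h hz).1) fun v₂ hok => ?_
    have hst := hok.exists_stage
    refine tb_ite (hd.tb_runAt (gs := [g₁]) (l := [v₂, z + 1, v, z, y]) (y := z + 1) (n := z) h₁ h₂
      h₃' rfl rfl rfl rfl (by simpa using hg) hst)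
      (fun v hv => tb_kst_zero_of_not fun h => hv (h hz).2.1) fun v₃ hz₂ => ?_
    refine TB.congr ?_ ⟨fun h _ => ⟨hok, hz₂, h⟩, fun h => (h hz).2.2⟩
    refine tb_all fun g₂ x => ?_
    refine tb_ite (tb_memAt (g := g) (x := x) (y := y) (by simpa using hg) rfl rfl)
      (fun v₄ hx => ?_) fun v hx => tb_kst_one_of fun _ => hx
    refine tb_ite (tb_memAt (g := g) (x := x) (y := z + 1) (by simpa using hg) rfl rfl)
      (fun v₅ hx' => ?_) fun v hx' => tb_kst_zero_of_not fun h => hx (h (Or.inl hx'))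
    refine (tb_neg (hd.tb_runAt (gs := [g₂, g₁]) (l := [v₅, v₄, x, v₃, v₂, z + 1, v, z, y])
      (y := z + 1) (n := x) h₁ h₂ h₃' rfl rfl rfl rfl (by simpa using hg) hst)).congr ?_
    simp [hx, hx']

/-- The step of the history induction is decided at all functions `g`: if one of the first two tests
fails, the value is `0`, and otherwise the section with index `0` is a stage. -/
lemma EvaluatesStages.tb_stepIdx (hd : EvaluatesStages d vF vf va H)
    (h₁ : Refers (RefAt Fs) E₁ vF) (h₂ : Refers (RefFun fs) E₂ vf) (h₃ : Refers (RefAt as) E₃ va)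
    (g : ℕ → ℕ) :
    TB (stepIdx interp d E₁ E₂ E₃) Fs (g :: fs) as (HistStep H (tailSet g) (g 0)) := by
  refine tb_ite tb_accIdx (fun v hv => tb_kst_zero_of_not fun h => hv h.1.secAcc) fun v hacc => ?_
  have hok : TB (run interp ((1, d, 0, 0, 0), E₁, shift 1 E₂, shift 1 E₃)) Fs (g :: fs) (v :: as)
      (Ok H (tailSet g) 0) := by
    obtain ⟨c, hc, hc'⟩ := hd.exists_performs_ok hacc h₁ (h₂.append_fun [g]) (h₃.append [v])
      (q := 0) rfl 0
    exact ⟨c, tcomp_run hc, hc'⟩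
  refine tb_ite hok (fun v hv => tb_kst_zero_of_not fun h => hv h.1) fun v₂ hok => ?_
  have hst := hok.exists_stage
  set k := g 0 with hk
  refine tb_cmp (v := k) (tcomp_cmp (tcomp_kst 0) (tcomp_app rfl)) ?_
  refine tb_cmp (tcomp_cmp (tcomp_arg (a := k) rfl)
    (tcomp_num (Primrec.fst.comp Primrec.unpair))) ?_
  refine tb_cmp (tcomp_cmp (tcomp_arg (a := k) rfl)
    (tcomp_num (Primrec.snd.comp Primrec.unpair))) ?_
  refine tb_cmp (tcomp_cmp (tcomp_arg (a := k.unpair.2) rfl) (tcomp_num Primrec.pred)) ?_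
  refine tb_cmp (tcomp_kst 0) ?_
  have hgs : ([g] ++ fs)[0]? = some g := rfl
  refine tb_ite (P := k.unpair.2 ≠ 0) ⟨k.unpair.2, tcomp_arg rfl, Iff.rfl⟩ (fun v₃ hy => ?_)
    fun v₃ hy => ?_
  · refine (hd.tb_runAt (gs := [g])
      (l := [v₃, 0, k.unpair.2.pred, k.unpair.2, k.unpair.1, k, v₂, v])
      (y := 0) (n := k.unpair.1) h₁ h₂ h₃ rfl rfl rfl rfl hgs hst).congr ?_
    simp [HistStep, hok, not_not.1 hy]
  · refine tb_ite (tb_memAt (g := g) (x := k.unpair.2.pred) (y := 0) rfl rfl rfl) (fun v₄ hb => ?_)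
      fun v hb => tb_kst_zero_of_not fun h => ?_
    · refine tb_ite (tb_memAt (g := g) (x := k.unpair.1) (y := 0) rfl rfl rfl)
        (fun v hx => tb_kst_zero_of_not fun h => ?_) fun v₅ hx => ?_
      · rcases h.2 with h | h
        · exact hy h.1
        · exact hx h.2.2.1
      · refine (hd.tb_runAt (gs := [g])
          (l := [v₅, v₄, v₃, 0, k.unpair.2.pred, k.unpair.2, k.unpair.1, k, v₂, v])
          (y := 0) (n := k.unpair.2.pred) h₁ h₂ h₃ rfl rfl rfl rfl hgs hst).congr ?_
        have hb' : sec (tailSet g) 0 (k.unpair.2 - 1) = false := by simpa using hb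
        simp [HistStep, hok, hy, hx, hb', Nat.pred_eq_sub_one]
    · rcases h.2 with h | h
      · exact hy h.1
      · have := h.2.1
        rw [← Nat.pred_eq_sub_one, hb] at this
        exact absurd this (by simp)

end

lemma taskIdx_eval {u m : ℕ} {E₁ E₂ E₃ : Env} {l : List ℕ} :
    taskIdx u ((0, 0, 0, seqNum l, m), E₁, E₂, E₃) =
      evalIdx u (seqNum l) E₁ E₂ (shift 1 E₃) := rfl

/-- The interpreter evaluates all indices correctly, in the liberal reading of the application
of `𝓘`, although it is itself evaluated in the original reading. -/
lemma evaluates_of_pComp {e : ℕ} {vF : List Tp2} {vf : List (ℕ → ℕ)} {va : List ℕ} {c : ℕ}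
    (h : PComp e vF vf va c) : Evaluates e vF vf va c := by
  induction h with
  | @s1 e Fs fs a as he =>
    intro m Fs fs as' E₁ E₂ E₃ h₁ h₂ h₃
    subst he
    rw [Performs, taskIdx_eval]
    simp only [evalIdx, seqNum, Encodable.encodek, Option.getD_some]
    exact tcomp_cmp (tcomp_arg (h₃.append [_]).head) tcomp_sidx
  | @s2 e Fs fs as q he =>
    intro m Fs fs as' E₁ E₂ E₃ h₁ h₂ h₃
    subst he
    rw [Performs, taskIdx_eval]
    simp only [evalIdx, seqNum, Encodable.encodek, Option.getD_some]
    exact tcomp_kst q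
  | @s3 e Fs fs a as he =>
    intro m Fs fs as' E₁ E₂ E₃ h₁ h₂ h₃
    subst he
    rw [Performs, taskIdx_eval]
    simp only [evalIdx, seqNum, Encodable.encodek, Option.getD_some]
    exact tcomp_arg (h₃.append [_]).head
  | @s4 e Fs fs as e₁ e₂ b c he _ _ ih₂ ih₁ =>
    intro m Fs fs as' E₁ E₂ E₃ h₁ h₂ h₃
    subst he
    rw [Performs, taskIdx_eval]
    simp only [evalIdx, seqNum, Encodable.encodek, Option.getD_some]
    have h₃' := h₃.append [code interp ((0, 0, 0, seqNum [4, e₁, e₂], m), E₁, E₂, E₃)]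
    exact tcomp_cmp (tcomp_run (ih₂ _ _ _ _ _ _ _ h₁ h₂ h₃'))
      (tcomp_run (ih₁ _ _ _ _ _ _ _ h₁ h₂ ((h₃'.append [b]).push rfl)))
  | @s6 e Fs fs as e₁ c t₁ t₂ t₃ he ht₁ ht₂ ht₃ _ ih =>
    intro m Fs fs as' E₁ E₂ E₃ h₁ h₂ h₃
    subst he
    rw [Performs, taskIdx_eval]
    simp only [evalIdx, seqNum, Encodable.encodek, Option.getD_some]
    have := tcomp_run (ih 0 _ _ _ _ _ _ (h₁.perm ht₁) (h₂.perm ht₂)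
      ((h₃.append [code interp ((0, 0, 0, seqNum [6, e₁, seqNum t₁, seqNum t₂, seqNum t₃], m),
        E₁, E₂, E₃)]).perm ht₃))
    simpa [seqNum, Encodable.encodek] using this
  | @s7 e Fs f fs a as he =>
    intro m Fs fs as' E₁ E₂ E₃ h₁ h₂ h₃
    subst he
    rw [Performs, taskIdx_eval]
    simp only [evalIdx, seqNum, Encodable.encodek, Option.getD_some]
    exact tcomp_cmp (tcomp_arg (h₃.append [_]).head) (tcomp_refApp h₂.head)
  | @s8_2 e F Fs fs as d he g _ ih =>
    intro m Fs fs as' E₁ E₂ E₃ h₁ h₂ h₃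
    subst he
    rw [Performs, taskIdx_eval]
    simp only [evalIdx, seqNum, Encodable.encodek, Option.getD_some]
    have h₃' := h₃.append [code interp ((0, 0, 0, seqNum [8, 2, d], m), E₁, E₂, E₃)]
    -- the functional is brought to the front for S8, and brought back for the evaluation of `d`
    have hF := h₁.head
    have hlen := (List.getElem?_eq_some_iff.1 hF).1
    obtain ⟨l', hl⟩ := permuted_swapList_eq_cons hF
    refine Kleene.s6 rfl (permCode_swapList hlen) (permCode_nil _) (permCode_nil _) ?_
    rw [permuted_nil, permuted_nil, hl]
    refine Kleene.s8_2 rfl g fun x => ?_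
    rw [← hl]
    refine Kleene.s6 rfl (permCode_swapList ?_) (permCode_nil _) (permCode_nil _) ?_
    · rwa [length_permuted (permCode_swapList hlen)]
    rw [permuted_nil, permuted_nil, permuted_swapList_permuted_swapList hlen]
    exact tcomp_run (ih x _ _ _ _ _ _ _ h₁ h₂ ((h₃'.append [x]).push rfl))
  | @s8_3 e Fs fs b as d he G _ A hA ih =>
    intro m Fs fs as' E₁ E₂ E₃ h₁ h₂ h₃
    subst he
    rw [Performs, taskIdx_eval]
    simp only [evalIdx, seqNum, Encodable.encodek, Option.getD_some]
    have h₃' := h₃.append [code interp ((0, 0, 0, seqNum [8, 3, d], m), E₁, E₂, E₃)]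
    obtain ⟨hA', -⟩ := PInd.eq_ind hA
    set H := totalize (codedPOp G) with hH
    have hd : EvaluatesStages d _ _ _ H := fun β n => by
      obtain ⟨c, hc, hc'⟩ := exists_mem_of_pInd hA β n
      exact ⟨c, hc', ih _ c hc⟩
    refine tcomp_cmp (tcomp_cmp (tcomp_arg h₃'.head)
      (tcomp_num (Primrec₂.natPair.comp .id (.const 0)))) ?_
    classical
    have hΓ : ∀ f n, (decide (HistStep H (tailSet (concat n f)) (concat n f 0))) = true ↔
        HistStep H f n := fun f n => by
      rw [decide_eq_true_eq, tailSet_concat]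
      rfl
    rw [hA', ← ind_histStep hΓ b]
    exact tcomp_iidx_of_tb (fun g => hd.tb_stepIdx h₁ h₂ h₃'.pop g) _
  | @s9 e Fs fs d as c he _ ih =>
    intro m Fs fs as' E₁ E₂ E₃ h₁ h₂ h₃
    subst he
    rw [Performs, taskIdx_eval]
    simp only [evalIdx, seqNum, Encodable.encodek, Option.getD_some]
    have h₃' := h₃.append [code interp ((0, 0, 0, seqNum [9], m), E₁, E₂, E₃)]
    exact tcomp_runAt h₃'.head h₃'.head (ih _ _ _ _ _ _ _ h₁ h₂ (h₃'.pop.append [_]))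

/-- The application of `𝓘` to a total functional is one in the liberal reading. -/
lemma pComp_of_tComp {e : ℕ} {Fs : List Tp2} {fs : List (ℕ → ℕ)} {as : List ℕ} {c : ℕ}
    (h : TComp e Fs fs as c) : PComp e Fs fs as c := by
  induction h with
  | s1 he => exact .s1 he
  | s2 he => exact .s2 he
  | s3 he => exact .s3 he
  | s4 he _ _ ih₂ ih₁ => exact .s4 he ih₂ ih₁
  | s6 he h₁ h₂ h₃ _ ih => exact .s6 he h₁ h₂ h₃ ih
  | s7 he => exact .s7 he
  | s8_2 he g _ ih => exact .s8_2 he g ih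
  | s8_3 he G _ A hA ih =>
    obtain ⟨G', rfl, rfl⟩ := hA
    exact .s8_3 he _ ih _ (pInd_of_total G')
  | s9 he _ ih => exact .s9 he ih

/-- The index that runs the interpreter on the evaluation of `e` at the actual arguments. -/
noncomputable def translate (e : ℕ) : ℕ :=
  run interp ((0, 0, 0, e, 0), ([], 0), ([], 0), ([], 0))

lemma primrec_translate : Primrec translate :=
  primrec_run (.const _) (primrec_task (.const 0) (.const 0) (.const 0) .id (.const 0) (.const _)
    (.const _) (.const _))

lemma tComp_translate {e : ℕ} {Fs : List Tp2} {fs : List (ℕ → ℕ)} {as : List ℕ} {c : ℕ}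
    (h : PComp e Fs fs as c) : TComp (translate e) Fs fs as c := by
  refine tcomp_run (evaluates_of_pComp h _ _ _ _ _ _ _ ?_ ?_ ?_)
  · intro i x hx
    simpa [RefAt, lookup] using hx
  · intro i x hx
    exact ⟨x, by simpa [lookup] using hx, by simp [lookup]⟩
  · intro i x hx
    simpa [RefAt, lookup] using hx

end NonMonotoneInduction

theorem mainTheorem7 :
    (∃ ρ : ℕ → ℕ, Computable ρ ∧
      ∀ (e : ℕ) (Fs : List NonMonotoneInduction.Tp2) (fs : List (ℕ → ℕ)) (as : List ℕ) (b : ℕ),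
        NonMonotoneInduction.PComp e Fs fs as b →
          NonMonotoneInduction.TComp (ρ e) Fs fs as b) ∧
    (∀ (D : Set (List NonMonotoneInduction.Tp2 × List (ℕ → ℕ) × List ℕ))
      (Φ : List NonMonotoneInduction.Tp2 → List (ℕ → ℕ) → List ℕ → ℕ),
        NonMonotoneInduction.ComputableOn NonMonotoneInduction.PComp D Φ ↔
          NonMonotoneInduction.ComputableOn NonMonotoneInduction.TComp D Φ) := by
  refine ⟨⟨NonMonotoneInduction.translate, NonMonotoneInduction.primrec_translate.to_comp,
    fun e Fs fs as b h => NonMonotoneInduction.tComp_translate h⟩, fun D Φ => ⟨?_, ?_⟩⟩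
  · rintro ⟨e, he⟩
    exact ⟨_, fun Fs fs as h => NonMonotoneInduction.tComp_translate (he Fs fs as h)⟩
  · rintro ⟨e, he⟩
    exact ⟨e, fun Fs fs as h => NonMonotoneInduction.pComp_of_tComp (he Fs fs as h)⟩
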